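/- Let $\mathcal H$ be an infinite-dimensional complex Hilbert space. Fix a $C^\infty$ function $w\ge 0$ on $\mathbb R$ with $\operatorname{supp} w\subset[\frac12,2]$ and $w(s)=1-w(s/2)$ for $s\in[1,2]$, and for $n\in\mathbb Z$ let $W_n$ be the function on $\mathbb R^2$ with $\int_{\mathbb R^2} W_n(x)e^{-i(x,t)}\,dx=w(\|t\|_2/2^n)$. The Besov class $B^1_{\infty,1}(\mathbb R^2)$ consists of the continuous functions $f:\mathbb R^2\to\mathbb C$ of at most polynomial growth such that $$\|f\|_{B^1_{\infty,1}}:=\sum_{n\in\mathbb Z}2^n\|f*W_n\|_{L^\infty}<\infty\quad\text{and}\quad \frac{\partial f}{\partial x_j}=\sum_{n\in\mathbb Z}\frac{\partial (f*W_n)}{\partial x_j}\ \text{ in } \mathscr S'(\mathbb R^2),\quad j=1,2.$$ For finite rank self-adjoint operators $A,B$ on $\mathcal H$ with spectral measures $E_A,E_B$ put $$f(A,B)=\iint f(x,y)\,dE_A(x)\,dE_B(y)=\sum_{x\in\sigma(A)}\sum_{y\in\sigma(B)}f(x,y)\,E_A(\{x\})E_B(\{y\}).$$ Let $\|\cdot\|$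 be the operator norm, and $\|T\|_{S_p}=\big(\sum_{j\ge0}s_j(T)^p\big)^{1/p}$ the Schatten–von Neumann norm, where the $s_j(T)$ are the singular values of $T$. **Theorem 8.2.** There exist a sequence $\{f_n\}_{n\ge0}$ of functions in $B^1_{\infty,1}(\mathbb R^2)$ and sequences $\{A_1^{(n)}\}_{n\ge0}$, $\{A_2^{(n)}\}_{n\ge0}$, $\{B^{(n)}\}_{n\ge0}$ of finite rank self-adjoint operators on $\mathcal H$ such that the norms $\|f_n\|_{B^1_{\infty,1}}$ do not depend on $n$, $$\lim_{n\to\infty}\|A_1^{(n)}-A_2^{(n)}\|=0,\qquad\text{but}\qquad \lim_{n\to\infty}\|f_n(A_1^{(n)},B^{(n)})-f_n(A_2^{(n)},B^{(n)})\|=\infty .$$ For every real $p>2$ there also exist such sequences (depending on $p$) with the norm of $S_p$ in place of the operator norm in both limits. Consequently there is no Lipschitz type estimate in these norms, even for small perturbations: for all $M<\infty$ and $\delta>0$ there are $f\in B^1_{\infty,1}(\mathbb R^2)$ and finite rank self-adjoint $A_1,A_2,B$ with $\|A_1-A_2\|<\delta$ and $$\|f(A_1,B)-f(A_2,B)\|>M\,\|f\|_{B^1_{\infty,1}}\|A_1-A_2\|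 ,$$ and, for every real $p>2$, the same holds with $\|\cdot\|_{S_p}$ in place of $\|\cdot\|$ throughout. -/

import Mathlib

open Filter Topology MeasureTheory
open scoped ENNReal NNReal SchwartzMap

noncomputable section

/-! ### The Besov class `B^1_{∞,1}(ℝ^d)` -/

/-- The windows `w` of a Littlewood–Paley decomposition: `w` is infinitely differentiable,
`w ≥ 0`, `supp w ⊆ [1/2, 2]` and `w(s) = 1 - w(s/2)` for `s ∈ [1, 2]`. -/
structure IsLittlewoodPaleyWindow (w : ℝ → ℝ) : Prop where
  smooth : ContDiff ℝ (⊤ : ℕ∞) w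
  nonneg : ∀ s, 0 ≤ w s
  supp : tsupport w ⊆ Set.Icc (1 / 2) 2
  partition : ∀ s ∈ Set.Icc (1 : ℝ) 2, w s = 1 - w (s / 2)

/-- The function `W_n` on `ℝ^d` with `∫ W_n(x) e^{-i(x,t)} dx = w(‖t‖ / 2^n)`, written as the
inverse Fourier transform `W_n(x) = (2π)^{-d} ∫ e^{i(x,t)} w(‖t‖ / 2^n) dt`. -/
def lpKernel {d : ℕ} (w : ℝ → ℝ) (n : ℤ) (x : EuclideanSpace ℝ (Fin d)) : ℂ :=
  ((2 * Real.pi) ^ d : ℂ)⁻¹ *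
    ∫ t : EuclideanSpace ℝ (Fin d),
      Complex.exp (Complex.I * (inner ℝ x t : ℝ)) * (w (‖t‖ / 2 ^ n) : ℂ)

/-- The Littlewood–Paley piece `f_n = f * W_n`. -/
def lpPiece {d : ℕ} (w : ℝ → ℝ) (f : EuclideanSpace ℝ (Fin d) → ℂ) (n : ℤ)
    (x : EuclideanSpace ℝ (Fin d)) : ℂ :=
  ∫ y : EuclideanSpace ℝ (Fin d), f (x - y) * lpKernel w n y

/-- `‖f‖_{B^1_{∞,1}} = ∑_{n ∈ ℤ} 2^n ‖f_n‖_{L^∞}`, as an element of `[0, ∞]`. -/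
def besovNorm {d : ℕ} (w : ℝ → ℝ) (f : EuclideanSpace ℝ (Fin d) → ℂ) : ℝ≥0∞ :=
  ∑' n : ℤ, (2 : ℝ≥0∞) ^ n * eLpNorm (lpPiece w f n) ∞ volume

/-- The value on the test function `ψ` of the distributional derivative `∂f/∂x_j`. -/
def weakPartial {d : ℕ} (f : EuclideanSpace ℝ (Fin d) → ℂ) (j : Fin d)
    (ψ : 𝓢(EuclideanSpace ℝ (Fin d), ℂ)) : ℂ :=
  -∫ x : EuclideanSpace ℝ (Fin d), f x * fderiv ℝ ψ x (EuclideanSpace.single j 1)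

/-- Membership in the (modified homogeneous) Besov class `B^1_{∞,1}(ℝ^d)`. Its elements are
continuous functions of at most polynomial growth, regarded as tempered distributions, for which
`∑_{n ∈ ℤ} 2^n ‖f_n‖_{L^∞} < ∞` and, for every first order partial derivative,
`∂f/∂x_j = ∑_{n ∈ ℤ} ∂f_n/∂x_j` in the space of tempered distributions (so that the only
polynomials in the class are the constants). -/
structure MemBesov {d : ℕ} (w : ℝ → ℝ) (f : EuclideanSpace ℝ (Fin d) → ℂ) : Prop where
  continuous : Continuous f
  growth : ∃ (C : ℝ) (k : ℕ), ∀ x, ‖f x‖ ≤ C * (1 + ‖x‖) ^ k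
  norm_lt_top : besovNorm w f < ∞
  hasSum_partial : ∀ (j : Fin d) (ψ : 𝓢(EuclideanSpace ℝ (Fin d), ℂ)),
    HasSum (fun n : ℤ => weakPartial (lpPiece w f n) j ψ) (weakPartial f j ψ)

/-! ### Operators -/

section Operators

variable {H : Type*} [NormedAddCommGroup H] [InnerProductSpace ℂ H] [CompleteSpace H]

/-- Self-adjoint operators of finite rank on a Hilbert space. -/
structure IsFiniteRankSelfAdjoint (A : H →L[ℂ] H) : Prop where
  isSelfAdjoint : IsSelfAdjoint A
  finiteRank : FiniteDimensional ℂ (LinearMap.range (A : H →ₗ[ℂ] H))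

/-- The value `E_A({x})` of the spectral measure of a self-adjoint operator `A` at the one-point
set `{x}`: the orthogonal projection onto `ker (A - x)`. -/
def spectralAtom (A : H →L[ℂ] H) (x : ℝ) : H →L[ℂ] H :=
  (A - (x : ℂ) • ContinuousLinearMap.id ℂ H).ker.starProjection

/-- The double operator integral `∬ Φ(x, y) dE_A(x) T dE_B(y)` for self-adjoint `A`, `B` of finite
rank. Their spectral measures are carried by the finite sets of their eigenvalues, so that the
integral is the finite sum of `Φ(x, y) E_A({x}) T E_B({y})`. -/
def doubleOpIntegral (Φ : ℝ → ℝ → ℂ) (A T B : H →L[ℂ] H) : H →L[ℂ] H :=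
  ∑ᶠ (x : ℝ) (y : ℝ), Φ x y • (spectralAtom A x ∘L T ∘L spectralAtom B y)

/-- The function `f(A, B) = ∬ f(x, y) dE_A(x) dE_B(y)` of a pair of (not necessarily commuting)
self-adjoint operators of finite rank. -/
def opFun (f : EuclideanSpace ℝ (Fin 2) → ℂ) (A B : H →L[ℂ] H) : H →L[ℂ] H :=
  doubleOpIntegral (fun x y => f !₂[x, y]) A (ContinuousLinearMap.id ℂ H) B

/-- The singular value `s_j(T)`, `j ≥ 0`: the distance in the operator norm from `T` to the
operators of rank at most `j`. -/
def singularNumber (j : ℕ) (T : H →L[ℂ] H) : ℝ≥0∞ :=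
  ⨅ K ∈ {K : H →L[ℂ] H | LinearMap.rank (K : H →ₗ[ℂ] H) ≤ j}, ‖T - K‖ₑ

/-- The Schatten–von Neumann norm `‖T‖_{S_p} = (∑_{j ≥ 0} s_j(T)^p)^{1/p}`, as an element of
`[0, ∞]`; it is finite if and only if `T ∈ S_p`. -/
def schattenNorm (p : ℝ) (T : H →L[ℂ] H) : ℝ≥0∞ :=
  (∑' j : ℕ, singularNumber j T ^ p) ^ (1 / p)

end Operators

end

/-! The difference is made large by a phase cancellation that turns a double sum into a rank-one
operator. Let `c` be the `N × N` Fourier matrix, `u` an orthonormal system of `N` vectors, and `v`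
its image under the unitary matrix with entries of modulus `N^{-1/2}`, so that `⟨u_i, v_j⟩ =
N^{-1/2} conj c_ij`. Let `A₂` and `B` have eigenvalues `1, …, N` on `u` and on `v`, and let `A₁` be
`A₂` with these eigenvalues shifted by a small `ε`. If `f` vanishes on the vertical lines through
the integers and `f(j + ε, k) = γ ε c_jk`, then `f(A₂, B) = 0`, while in `f(A₁, B) = γ ε ∑ c_jk P_j
Q_k` (`P_j`, `Q_k` the projections onto `u_j`, `v_k`) the phases cancel. What remains is `γ ε
N^{-1/2} ∑ ⟨v_k, ·⟩ u_j`, of norm `γ ε √N` (`le_norm_sum_rankOne_comp_rankOne`).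

Such an `f` costs nothing in `N`: it is a sum of disjointly supported bumps at lattice points with
unimodular coefficients, so its sup norm and its second differences are bounded uniformly in `N`.
These two bounds control the low and the high frequencies of the Besov norm (`exists_besovNorm_le`).
Normalizing the norm to 1 therefore keeps `γ ≥ κ > 0` (`exists_memBesov_lattice`).

The perturbation has operator norm at most `ε` and rank at most `N`, hence `S_p` norm at most `ε
N^{1/p}`. With `ε` of order `N^{-s}`, it tends to zero while the increment grows like `N^{1/2 - s}`,
provided `0 < s < 1/2`, respectively `1/p < s < 1/2`; the latter range is nonempty exactly when `p >
2`. -/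

noncomputable section

/-! ### Littlewood–Paley kernels and their Fourier symbols -/

section LittlewoodPaley

open FourierTransform

variable {w : ℝ → ℝ}

namespace IsLittlewoodPaleyWindow

lemma eq_zero_of_lt (hw : IsLittlewoodPaleyWindow w) {s : ℝ} (hs : s < 1 / 2) : w s = 0 :=
  image_eq_zero_of_notMem_tsupport fun h => absurd (hw.supp h).1 (not_le.mpr hs)

/-- The endpoint 2 may lie in the support, but continuity forces the value 0 there. `hasSum_dilates`
needs it when `s` is a power of 2. -/
lemma eq_zero_of_two_le (hw : IsLittlewoodPaleyWindow w) {s : ℝ} (hs : 2 ≤ s) : w s = 0 := by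
  have hcl : IsClosed {s | w s = 0} := isClosed_eq hw.smooth.continuous continuous_const
  have hsub : Set.Ioi (2 : ℝ) ⊆ {s | w s = 0} := fun s hs =>
    image_eq_zero_of_notMem_tsupport fun h => absurd (hw.supp h).2 (not_le.mpr hs)
  have := hcl.closure_subset_iff.mpr hsub
  rw [closure_Ioi] at this
  exact this hs

/-- If `2^m ≤ s < 2^(m+1)`, only `n = m` and `n = m + 1` contribute, and these two terms add up to 1
by the partition identity at `s / 2^m`. -/
lemma hasSum_dilates (hw : IsLittlewoodPaleyWindow w) {s : ℝ} (hs : 0 < s) :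
    HasSum (fun n : ℤ => w (s / 2 ^ n)) 1 := by
  obtain ⟨m, hm⟩ := exists_mem_Ico_zpow hs (one_lt_two : (1 : ℝ) < 2)
  have h2 : (0 : ℝ) < 2 ^ m := by positivity
  have h1 : s / 2 ^ m ∈ Set.Icc (1 : ℝ) 2 := by
    rw [zpow_add_one₀ two_ne_zero] at hm
    constructor
    · rw [le_div_iff₀ h2]; linarith [hm.1]
    · rw [div_le_iff₀ h2]; linarith [hm.2]
  have hsum : ∑ n ∈ ({m, m + 1} : Finset ℤ), w (s / 2 ^ n) = 1 := by
    rw [Finset.sum_pair (by lia), hw.partition _ h1, zpow_add_one₀ two_ne_zero, div_div]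
    ring
  rw [← hsum]
  refine hasSum_sum_of_ne_finset_zero fun n hn => ?_
  simp only [Finset.mem_insert, Finset.mem_singleton, not_or] at hn
  rcases lt_or_gt_of_ne hn.1 with h | h
  · refine hw.eq_zero_of_two_le ?_
    have : (2 : ℝ) ^ (n + 1) ≤ 2 ^ m := zpow_le_zpow_right₀ one_le_two (by lia)
    rw [zpow_add_one₀ two_ne_zero] at this
    rw [le_div_iff₀ (by positivity)]
    linarith [hm.1]
  · refine hw.eq_zero_of_lt ?_
    have : (2 : ℝ) ^ (m + 1 + 1) ≤ 2 ^ n := zpow_le_zpow_right₀ one_le_two (by lia)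
    rw [zpow_add_one₀ two_ne_zero] at this
    rw [div_lt_iff₀ (by positivity)]
    linarith [hm.2]

end IsLittlewoodPaleyWindow

variable {d : ℕ}

/-- The Fourier multiplier of the `n`-th Littlewood–Paley projection, in the normalization
`𝓕 f(ξ) = ∫ f(x) e^{-2πi(x,ξ)} dx` of the Fourier transform. -/
def lpSymbol (d : ℕ) (w : ℝ → ℝ) (n : ℤ) (ξ : EuclideanSpace ℝ (Fin d)) : ℂ :=
  (w (2 * Real.pi * ‖ξ‖ / 2 ^ n) : ℂ)

namespace IsLittlewoodPaleyWindow

/-- The norm is not smooth at the origin, but the symbol vanishes in a neighbourhood of it. -/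
lemma contDiff_lpSymbol (hw : IsLittlewoodPaleyWindow w) (n : ℤ) :
    ContDiff ℝ (⊤ : ℕ∞) (lpSymbol d w n) := by
  have h2 : (0 : ℝ) < 2 ^ n := by positivity
  rw [contDiff_iff_contDiffAt]
  intro ξ
  by_cases hξ : ξ = 0
  · subst hξ
    have hc : Tendsto (fun ξ : EuclideanSpace ℝ (Fin d) => 2 * Real.pi * ‖ξ‖ / 2 ^ n)
        (𝓝 0) (𝓝 0) := by
      have : Continuous fun ξ : EuclideanSpace ℝ (Fin d) => 2 * Real.pi * ‖ξ‖ / 2 ^ n := by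
        fun_prop
      simpa using this.tendsto 0
    refine (contDiffAt_const (c := (0 : ℂ))).congr_of_eventuallyEq ?_
    filter_upwards [hc.eventually (gt_mem_nhds (by norm_num : (0 : ℝ) < 1 / 2))] with ξ hξ
    simp [lpSymbol, hw.eq_zero_of_lt hξ]
  · have h1 : ContDiffAt ℝ (⊤ : ℕ∞)
        (fun ξ : EuclideanSpace ℝ (Fin d) => 2 * Real.pi * ‖ξ‖ / 2 ^ n) ξ :=
      (contDiffAt_const.mul (contDiffAt_norm ℝ hξ)).div_const _
    exact Complex.ofRealCLM.contDiff.contDiffAt.comp ξ (hw.smooth.contDiffAt.comp ξ h1)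

lemma hasCompactSupport_lpSymbol (hw : IsLittlewoodPaleyWindow w) (n : ℤ) :
    HasCompactSupport (lpSymbol d w n) := by
  have h2 : (0 : ℝ) < 2 ^ n := by positivity
  refine HasCompactSupport.intro (isCompact_closedBall 0 (2 ^ n)) fun ξ hξ => ?_
  rw [Metric.mem_closedBall, dist_zero_right, not_le] at hξ
  rw [lpSymbol, hw.eq_zero_of_two_le, Complex.ofReal_zero]
  rw [le_div_iff₀ h2]
  nlinarith [Real.pi_gt_three]

/-- The Littlewood–Paley multiplier as a Schwartz function. -/
def symbol (d : ℕ) (hw : IsLittlewoodPaleyWindow w) (n : ℤ) : 𝓢(EuclideanSpace ℝ (Fin d), ℂ) :=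
  (hw.hasCompactSupport_lpSymbol (d := d) n).toSchwartzMap (hw.contDiff_lpSymbol n)

@[simp]
lemma symbol_apply (hw : IsLittlewoodPaleyWindow w) (n : ℤ) (ξ : EuclideanSpace ℝ (Fin d)) :
    hw.symbol d n ξ = (w (2 * Real.pi * ‖ξ‖ / 2 ^ n) : ℂ) := rfl

lemma hasSum_symbol (hw : IsLittlewoodPaleyWindow w) {ξ : EuclideanSpace ℝ (Fin d)} (hξ : ξ ≠ 0) :
    HasSum (fun n => hw.symbol d n ξ) 1 := by
  have hpos : 0 < 2 * Real.pi * ‖ξ‖ := by have := Real.pi_pos; positivity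
  simpa using Complex.hasSum_ofReal.mpr (hw.hasSum_dilates hpos)

lemma hasSum_norm_symbol (hw : IsLittlewoodPaleyWindow w) {ξ : EuclideanSpace ℝ (Fin d)}
    (hξ : ξ ≠ 0) : HasSum (fun n => ‖hw.symbol d n ξ‖) 1 := by
  have hpos : 0 < 2 * Real.pi * ‖ξ‖ := by have := Real.pi_pos; positivity
  simpa [abs_of_nonneg (hw.nonneg _)] using hw.hasSum_dilates hpos

/-- The substitution `t = 2πξ` absorbs the factor `(2π)^{-d}`. -/
lemma lpKernel_eq_fourierInv (hw : IsLittlewoodPaleyWindow w) (n : ℤ) :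
    lpKernel (d := d) w n = 𝓕⁻ (hw.symbol d n) := by
  have h2 := Real.two_pi_pos
  ext x
  have h := Measure.integral_comp_smul (volume : Measure (EuclideanSpace ℝ (Fin d)))
    (fun t => Complex.exp (Complex.I * (inner ℝ x t : ℝ)) * (w (‖t‖ / 2 ^ n) : ℂ)) (2 * Real.pi)
  rw [finrank_euclideanSpace_fin, abs_of_pos (by positivity), Complex.real_smul] at h
  rw [lpKernel, SchwartzMap.fourierInv_coe, Real.fourierInv_eq']
  push_cast at h
  rw [← h]
  refine integral_congr_ae (Eventually.of_forall fun ξ => ?_)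
  simp only [inner_smul_right, norm_smul, Real.norm_of_nonneg h2.le, symbol_apply, smul_eq_mul,
    real_inner_comm x ξ]
  congr 2
  push_cast
  ring

/-- The kernel `W_n` as a Schwartz function. -/
def kernel (d : ℕ) (hw : IsLittlewoodPaleyWindow w) (n : ℤ) : 𝓢(EuclideanSpace ℝ (Fin d), ℂ) :=
  𝓕⁻ (hw.symbol d n)

lemma coe_kernel (hw : IsLittlewoodPaleyWindow w) (n : ℤ) :
    (hw.kernel d n : EuclideanSpace ℝ (Fin d) → ℂ) = lpKernel w n :=
  (hw.lpKernel_eq_fourierInv n).symm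

/-- The integral is the symbol at frequency zero, where `w` vanishes. -/
lemma integral_lpKernel (hw : IsLittlewoodPaleyWindow w) (n : ℤ) :
    ∫ y : EuclideanSpace ℝ (Fin d), lpKernel w n y = 0 := by
  have h : 𝓕 (hw.kernel d n) 0 = 0 := by
    simp [kernel, hw.eq_zero_of_lt]
  rw [SchwartzMap.fourier_coe, Real.fourier_eq'] at h
  simpa [coe_kernel] using h

end IsLittlewoodPaleyWindow

lemma lpKernel_neg (n : ℤ) (x : EuclideanSpace ℝ (Fin d)) :
    lpKernel w n (-x) = lpKernel w n x := by
  rw [lpKernel, lpKernel, ← integral_neg_eq_self]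
  simp

lemma lpKernel_eq_dilate (n : ℤ) (x : EuclideanSpace ℝ (Fin d)) :
    lpKernel w n x = ((2 : ℝ) ^ n) ^ d * lpKernel w 0 ((2 : ℝ) ^ n • x) := by
  have h2 : (0 : ℝ) < 2 ^ n := by positivity
  have h := Measure.integral_comp_smul (volume : Measure (EuclideanSpace ℝ (Fin d)))
    (fun t => Complex.exp (Complex.I * (inner ℝ x t : ℝ)) * (w (‖t‖ / 2 ^ n) : ℂ)) (2 ^ n)
  rw [finrank_euclideanSpace_fin, abs_of_pos (by positivity), Complex.real_smul] at h
  rw [lpKernel, lpKernel]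
  have h' : ∀ t : EuclideanSpace ℝ (Fin d),
      Complex.exp (Complex.I * (inner ℝ ((2 : ℝ) ^ n • x) t : ℝ)) * (w (‖t‖ / 2 ^ (0 : ℤ)) : ℂ) =
      Complex.exp (Complex.I * (inner ℝ x ((2 : ℝ) ^ n • t) : ℝ)) *
        (w (‖(2 : ℝ) ^ n • t‖ / 2 ^ n) : ℂ) := by
    intro t
    rw [inner_smul_left, inner_smul_right, norm_smul, Real.norm_of_nonneg h2.le,
      mul_div_cancel_left₀ _ h2.ne']
    simp
  simp_rw [h', h]
  have h3 : (((2 : ℝ) ^ n : ℝ) : ℂ) ^ d ≠ 0 := by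
    exact_mod_cast (pow_pos h2 d).ne'
  push_cast at h3 ⊢
  field_simp

lemma integral_norm_pow_mul_norm_lpKernel (n : ℤ) (k : ℕ) :
    ∫ y : EuclideanSpace ℝ (Fin d), ‖y‖ ^ k * ‖lpKernel w n y‖ =
      (((2 : ℝ) ^ n) ^ k)⁻¹ * ∫ y : EuclideanSpace ℝ (Fin d), ‖y‖ ^ k * ‖lpKernel w 0 y‖ := by
  have h2 : (0 : ℝ) < 2 ^ n := by positivity
  have h := Measure.integral_comp_smul (volume : Measure (EuclideanSpace ℝ (Fin d)))
    (fun y => ‖y‖ ^ k * ‖lpKernel w 0 y‖) (2 ^ n)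
  rw [finrank_euclideanSpace_fin, abs_of_pos (by positivity), smul_eq_mul] at h
  have h' : ∀ y : EuclideanSpace ℝ (Fin d), ‖y‖ ^ k * ‖lpKernel w n y‖ =
      (((2 : ℝ) ^ n) ^ d / ((2 : ℝ) ^ n) ^ k) *
        (‖(2 : ℝ) ^ n • y‖ ^ k * ‖lpKernel w 0 ((2 : ℝ) ^ n • y)‖) := by
    intro y
    rw [lpKernel_eq_dilate n, norm_mul, norm_smul, Real.norm_of_nonneg h2.le, norm_pow,
      norm_zpow, Complex.norm_real, Real.norm_ofNat, mul_pow]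
    field_simp
  simp_rw [h', integral_const_mul, h]
  field_simp

end LittlewoodPaley

/-! ### Reconstruction of Schwartz functions and bounds for the Besov norm -/

section BesovNorm

open FourierTransform

variable {w : ℝ → ℝ} {d : ℕ}

lemma lpPiece_const_mul (c : ℂ) (f : EuclideanSpace ℝ (Fin d) → ℂ) (n : ℤ) :
    lpPiece w (fun x => c * f x) n = fun x => c * lpPiece w f n x := by
  ext x
  simp only [lpPiece, mul_assoc]
  exact integral_const_mul _ _

lemma besovNorm_const_mul (c : ℂ) (f : EuclideanSpace ℝ (Fin d) → ℂ) :
    besovNorm w (fun x => c * f x) = ‖c‖ₑ * besovNorm w f := by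
  rw [besovNorm, besovNorm, ← ENNReal.tsum_mul_left]
  refine tsum_congr fun n => ?_
  rw [lpPiece_const_mul]
  have : (fun x => c * lpPiece w f n x) = c • lpPiece w f n := rfl
  rw [this, eLpNorm_const_smul]
  ring

namespace IsLittlewoodPaleyWindow

/-- The Littlewood–Paley piece of a Schwartz function, as a Schwartz function. -/
def piece (hw : IsLittlewoodPaleyWindow w) (f : 𝓢(EuclideanSpace ℝ (Fin d), ℂ)) (n : ℤ) :
    𝓢(EuclideanSpace ℝ (Fin d), ℂ) :=
  SchwartzMap.convolution (ContinuousLinearMap.mul ℂ ℂ) (hw.kernel d n) f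

lemma coe_piece (hw : IsLittlewoodPaleyWindow w) (f : 𝓢(EuclideanSpace ℝ (Fin d), ℂ)) (n : ℤ) :
    (hw.piece f n : EuclideanSpace ℝ (Fin d) → ℂ) = lpPiece w f n := by
  ext x
  rw [piece, SchwartzMap.convolution_apply, convolution_def, lpPiece, coe_kernel]
  simp [mul_comm]

lemma piece_apply (hw : IsLittlewoodPaleyWindow w) (f : 𝓢(EuclideanSpace ℝ (Fin d), ℂ)) (n : ℤ)
    (x : EuclideanSpace ℝ (Fin d)) :
    hw.piece f n x = ∫ ξ, Real.fourierChar (inner ℝ ξ x) • (hw.symbol d n ξ * 𝓕 f ξ) := by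
  have h : hw.piece f n = 𝓕⁻ (𝓕 (hw.piece f n)) := by simp
  rw [h, SchwartzMap.fourierInv_coe, Real.fourierInv_eq, piece, SchwartzMap.fourier_convolution,
    kernel]
  simp

lemma norm_piece_le (hw : IsLittlewoodPaleyWindow w) (f : 𝓢(EuclideanSpace ℝ (Fin d), ℂ)) (n : ℤ)
    (x : EuclideanSpace ℝ (Fin d)) :
    ‖hw.piece f n x‖ ≤ ∫ ξ, ‖hw.symbol d n ξ‖ * ‖𝓕 f ξ‖ := by
  rw [piece_apply]
  refine (norm_integral_le_integral_norm _).trans (le_of_eq ?_)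
  simp only [Circle.norm_smul, norm_mul]

section Reconstruction

variable [Nontrivial (EuclideanSpace ℝ (Fin d))]

/-- The symbols sum to 1 only off the origin, which is a null set because the space is nontrivial.
-/
lemma ae_hasSum_norm_symbol_mul (hw : IsLittlewoodPaleyWindow w)
    (f : 𝓢(EuclideanSpace ℝ (Fin d), ℂ)) :
    ∀ᵐ ξ, HasSum (fun n => ‖hw.symbol d n ξ‖ * ‖𝓕 f ξ‖) ‖𝓕 f ξ‖ := by
  filter_upwards [Measure.ae_ne volume (0 : EuclideanSpace ℝ (Fin d))] with ξ hξ
  simpa using (hw.hasSum_norm_symbol hξ).mul_right ‖𝓕 f ξ‖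

lemma integrable_tsum_norm_symbol_mul (hw : IsLittlewoodPaleyWindow w)
    (f : 𝓢(EuclideanSpace ℝ (Fin d), ℂ)) :
    Integrable fun ξ => ∑' n, ‖hw.symbol d n ξ‖ * ‖𝓕 f ξ‖ := by
  refine (𝓕 f).integrable.norm.congr ?_
  filter_upwards [hw.ae_hasSum_norm_symbol_mul f] with ξ hξ
  exact hξ.tsum_eq.symm

lemma summable_integral_norm_symbol_mul (hw : IsLittlewoodPaleyWindow w)
    (f : 𝓢(EuclideanSpace ℝ (Fin d), ℂ)) :
    Summable fun n => ∫ ξ, ‖hw.symbol d n ξ‖ * ‖𝓕 f ξ‖ := by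
  refine (hasSum_integral_of_dominated_convergence
    (F := fun n ξ => ‖hw.symbol d n ξ‖ * ‖𝓕 f ξ‖) (f := fun ξ => ‖𝓕 f ξ‖)
    (fun n ξ => ‖hw.symbol d n ξ‖ * ‖𝓕 f ξ‖) (fun n => ?_) (fun n => ?_) ?_
    (hw.integrable_tsum_norm_symbol_mul f) (hw.ae_hasSum_norm_symbol_mul f)).summable
  · exact ((hw.symbol d n).continuous.norm.mul (𝓕 f).continuous.norm).aestronglyMeasurable
  · exact Eventually.of_forall fun ξ => by simp
  · filter_upwards [hw.ae_hasSum_norm_symbol_mul f] with ξ hξ using hξ.summable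

/-- The Littlewood–Paley decomposition of a Schwartz function converges pointwise. -/
lemma hasSum_piece (hw : IsLittlewoodPaleyWindow w) (f : 𝓢(EuclideanSpace ℝ (Fin d), ℂ))
    (x : EuclideanSpace ℝ (Fin d)) : HasSum (fun n => hw.piece f n x) (f x) := by
  have hf : f x = ∫ ξ, Real.fourierChar (inner ℝ ξ x) • 𝓕 f ξ := by
    have h : f = 𝓕⁻ (𝓕 f) := by simp
    conv_lhs => rw [h, SchwartzMap.fourierInv_coe, Real.fourierInv_eq]
  simp_rw [hf, piece_apply]
  refine hasSum_integral_of_dominated_convergence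
    (fun n ξ => ‖hw.symbol d n ξ‖ * ‖𝓕 f ξ‖) (fun n => ?_) (fun n => ?_) ?_
    (hw.integrable_tsum_norm_symbol_mul f) ?_
  · have h1 : Continuous fun ξ : EuclideanSpace ℝ (Fin d) =>
        Real.fourierChar (inner ℝ ξ x) := by fun_prop
    exact (h1.smul ((hw.symbol d n).continuous.mul (𝓕 f).continuous)).aestronglyMeasurable
  · exact Eventually.of_forall fun ξ => by simp [Circle.norm_smul]
  · filter_upwards [hw.ae_hasSum_norm_symbol_mul f] with ξ hξ using hξ.summable
  · filter_upwards [Measure.ae_ne volume (0 : EuclideanSpace ℝ (Fin d))] with ξ hξ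
    simpa using ((hw.hasSum_symbol hξ).mul_right (𝓕 f ξ)).const_smul
      (Real.fourierChar (inner ℝ ξ x))

/-- Each piece is bounded uniformly in `x` by a constant, and these constants are summable in `n`,
so the pointwise reconstruction can be integrated against a derivative of the test function. -/
lemma hasSum_weakPartial (hw : IsLittlewoodPaleyWindow w) (f : 𝓢(EuclideanSpace ℝ (Fin d), ℂ))
    (j : Fin d) (ψ : 𝓢(EuclideanSpace ℝ (Fin d), ℂ)) :
    HasSum (fun n : ℤ => weakPartial (lpPiece w f n) j ψ) (weakPartial f j ψ) := by
  set φ : 𝓢(EuclideanSpace ℝ (Fin d), ℂ) :=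
    LineDeriv.lineDerivOp (EuclideanSpace.single j (1 : ℝ)) ψ with hφ
  have hφ' : ∀ x, fderiv ℝ ψ x (EuclideanSpace.single j 1) = φ x := fun x =>
    (SchwartzMap.lineDerivOp_apply_eq_fderiv _ ψ x).symm
  simp only [weakPartial, hφ']
  refine HasSum.neg ?_
  have hs := hw.summable_integral_norm_symbol_mul f
  refine hasSum_integral_of_dominated_convergence
    (fun n x => (∫ ξ, ‖hw.symbol d n ξ‖ * ‖𝓕 f ξ‖) * ‖φ x‖) (fun n => ?_) (fun n => ?_) ?_ ?_ ?_
  · rw [← coe_piece hw]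
    exact ((hw.piece f n).continuous.mul φ.continuous).aestronglyMeasurable
  · refine Eventually.of_forall fun x => ?_
    rw [← coe_piece hw, norm_mul]
    exact mul_le_mul_of_nonneg_right (hw.norm_piece_le f n x) (norm_nonneg _)
  · exact Eventually.of_forall fun x => hs.mul_right _
  · simp_rw [tsum_mul_right]
    exact φ.integrable.norm.const_mul _
  · refine Eventually.of_forall fun x => ?_
    simpa only [← coe_piece hw] using (hw.hasSum_piece f x).mul_right (φ x)

lemma besovNorm_ne_zero (hw : IsLittlewoodPaleyWindow w) {f : 𝓢(EuclideanSpace ℝ (Fin d), ℂ)}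
    (hf : f ≠ 0) : besovNorm w f ≠ 0 := by
  contrapose! hf
  have h : ∀ n, hw.piece f n = 0 := by
    intro n
    have h1 : (2 : ℝ≥0∞) ^ n * eLpNorm (lpPiece w f n) ∞ volume = 0 :=
      ENNReal.tsum_eq_zero.mp hf n
    rw [← coe_piece hw] at h1
    rcases mul_eq_zero.mp h1 with h2 | h2
    · exact absurd h2 (ENNReal.zpow_pos two_ne_zero ENNReal.ofNat_ne_top n).ne'
    · rw [eLpNorm_eq_zero_iff (hw.piece f n).continuous.aestronglyMeasurable (by simp)] at h2
      exact DFunLike.coe_injective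
        ((hw.piece f n).continuous.ae_eq_iff_eq volume continuous_const |>.mp h2)
  ext x
  have h1 := hw.hasSum_piece f x
  simp only [h, zero_apply] at h1
  exact h1.unique hasSum_zero

end Reconstruction

/-- The `L¹` norm of the kernel is invariant under its dilations, so the bound does not depend on
`n`. -/
lemma norm_lpPiece_le_of_norm_le (hw : IsLittlewoodPaleyWindow w)
    {f : EuclideanSpace ℝ (Fin d) → ℂ} {M : ℝ} (hM : ∀ x, ‖f x‖ ≤ M) (n : ℤ)
    (x : EuclideanSpace ℝ (Fin d)) :
    ‖lpPiece w f n x‖ ≤ M * ∫ y : EuclideanSpace ℝ (Fin d), ‖lpKernel w 0 y‖ := by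
  have h0 := integral_norm_pow_mul_norm_lpKernel (w := w) (d := d) n 0
  simp only [pow_zero, one_mul, inv_one] at h0
  rw [← h0, ← integral_const_mul]
  refine norm_integral_le_of_norm_le ?_ (Eventually.of_forall fun y => ?_)
  · rw [← coe_kernel hw]
    exact (hw.kernel d n).integrable.norm.const_mul M
  · rw [norm_mul]
    exact mul_le_mul_of_nonneg_right (hM _) (norm_nonneg _)

/-- The kernel is even and has integral zero, so twice the piece is the integral of the second
difference of `f` against the kernel. The second moment of the kernel scales like `2^{-2n}`. -/
lemma norm_lpPiece_le_of_norm_second_difference_le (hw : IsLittlewoodPaleyWindow w)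
    (f : 𝓢(EuclideanSpace ℝ (Fin d), ℂ)) {C : ℝ}
    (hC : ∀ x y, ‖f (x + y) + f (x - y) - 2 * f x‖ ≤ C * ‖y‖ ^ 2) (n : ℤ)
    (x : EuclideanSpace ℝ (Fin d)) :
    ‖lpPiece w f n x‖ ≤
      C * (((2 : ℝ) ^ n) ^ 2)⁻¹ * ∫ y : EuclideanSpace ℝ (Fin d), ‖y‖ ^ 2 * ‖lpKernel w 0 y‖ := by
  have hK : Integrable (lpKernel w n : EuclideanSpace ℝ (Fin d) → ℂ) := by
    rw [← coe_kernel hw]; exact (hw.kernel d n).integrable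
  obtain ⟨M, -, hM⟩ := f.decay 0 0
  simp only [pow_zero, one_mul, norm_iteratedFDeriv_zero] at hM
  have hi : ∀ g : EuclideanSpace ℝ (Fin d) → EuclideanSpace ℝ (Fin d), Continuous g →
      Integrable fun y => f (g y) * lpKernel w n y := fun g hg =>
    hK.bdd_mul (c := M) (f.continuous.comp hg).aestronglyMeasurable
      (Eventually.of_forall fun y => hM _)
  have h1 : lpPiece w f n x = ∫ y, f (x + y) * lpKernel w n y := by
    rw [lpPiece, ← integral_neg_eq_self]
    simp [lpKernel_neg]
  have h2 : 2 * lpPiece w f n x =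
      ∫ y, (f (x + y) + f (x - y) - 2 * f x) * lpKernel w n y := by
    have h3 : ∫ y : EuclideanSpace ℝ (Fin d), 2 * f x * lpKernel w n y = 0 := by
      rw [integral_const_mul, hw.integral_lpKernel, mul_zero]
    simp only [sub_mul, add_mul]
    have hp := hi (fun y => x + y) (by fun_prop)
    have hm := hi (fun y => x - y) (by fun_prop)
    have h5 := integral_sub (hp.add hm) (hK.const_mul (2 * f x))
    simp only [Pi.add_apply] at h5
    rw [h5, h3, integral_add hp hm, ← h1, sub_zero, two_mul, lpPiece]
  have h4 : ‖2 * lpPiece w f n x‖ ≤ ∫ y : EuclideanSpace ℝ (Fin d), C * (‖y‖ ^ 2 * ‖lpKernel w n y‖) := by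
    rw [h2]
    refine norm_integral_le_of_norm_le ?_ (Eventually.of_forall fun y => ?_)
    · rw [← coe_kernel hw]
      exact ((hw.kernel d n).integrable_pow_mul volume 2).const_mul C
    · rw [norm_mul, ← mul_assoc]
      exact mul_le_mul_of_nonneg_right (hC x y) (norm_nonneg _)
  rw [integral_const_mul, integral_norm_pow_mul_norm_lpKernel, ← mul_assoc, norm_mul] at h4
  refine le_trans ?_ h4
  norm_num
  linarith [norm_nonneg (lpPiece w f n x)]

end IsLittlewoodPaleyWindow

lemma summable_half_pow_natAbs : Summable fun n : ℤ => (1 / 2 : ℝ) ^ n.natAbs := by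
  refine Summable.of_nat_of_neg ?_ ?_ <;>
    simpa using summable_geometric_of_lt_one (by norm_num : (0 : ℝ) ≤ 2⁻¹) (by norm_num)

/-- A bounded function with bounded second differences has finite norm in `B^1_{∞,1}`. -/
lemma IsLittlewoodPaleyWindow.exists_besovNorm_le (d : ℕ) (hw : IsLittlewoodPaleyWindow w)
    {M C : ℝ} (hM0 : 0 ≤ M) (hC0 : 0 ≤ C) :
    ∃ K : ℝ, ∀ f : 𝓢(EuclideanSpace ℝ (Fin d), ℂ), (∀ x, ‖f x‖ ≤ M) →
      (∀ x y, ‖f (x + y) + f (x - y) - 2 * f x‖ ≤ C * ‖y‖ ^ 2) →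
      besovNorm w f ≤ ENNReal.ofReal K := by
  set K₀ := ∫ y : EuclideanSpace ℝ (Fin d), ‖lpKernel w 0 y‖
  set K₂ := ∫ y : EuclideanSpace ℝ (Fin d), ‖y‖ ^ 2 * ‖lpKernel w 0 y‖
  have hK₀ : 0 ≤ K₀ := integral_nonneg fun y => norm_nonneg _
  have hK₂ : 0 ≤ K₂ := integral_nonneg fun y => by positivity
  set D := M * K₀ + C * K₂
  have hD : 0 ≤ D := by positivity
  refine ⟨∑' n : ℤ, D * (1 / 2 : ℝ) ^ n.natAbs, fun f hM hC => ?_⟩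
  rw [ENNReal.ofReal_tsum_of_nonneg (fun n => by positivity)
    (summable_half_pow_natAbs.mul_left D)]
  refine ENNReal.tsum_le_tsum fun n => ?_
  have h2 : (2 : ℝ≥0∞) ^ n = ENNReal.ofReal (2 ^ n) := by
    have := ENNReal.coe_zpow (r := 2) two_ne_zero n
    rw [ENNReal.ofReal, Real.toNNReal_zpow zero_le_two]
    simp at this ⊢
  have hb : ∀ b : ℝ, (∀ x, ‖lpPiece w f n x‖ ≤ b) →
      (2 : ℝ≥0∞) ^ n * eLpNorm (lpPiece w f n) ∞ volume ≤ ENNReal.ofReal (2 ^ n * b) := by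
    intro b hb
    rw [h2, ENNReal.ofReal_mul (by positivity), eLpNorm_exponent_top]
    gcongr
    exact eLpNormEssSup_le_of_ae_bound (Eventually.of_forall hb)
  -- After multiplication by `2^n`, second differences give a term of order `2^{-n}` for `n ≥ 0`,
  -- and the sup bound gives one of order `2^n` for `n ≤ 0`.
  rcases le_total 0 n with hn | hn
  · lift n to ℕ using hn
    refine (hb _ fun x => hw.norm_lpPiece_le_of_norm_second_difference_le f hC n x).trans
      (ENNReal.ofReal_le_ofReal ?_)
    have : (2 : ℝ) ^ (n : ℤ) * (C * (((2 : ℝ) ^ (n : ℤ)) ^ 2)⁻¹ * K₂) =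
        C * K₂ * (1 / 2) ^ n := by
      rw [zpow_natCast, one_div, inv_pow]
      field_simp
    rw [this, Int.natAbs_natCast]
    gcongr
    linarith [mul_nonneg hM0 hK₀]
  · obtain ⟨k, rfl⟩ : ∃ k : ℕ, n = -k := ⟨n.natAbs, by lia⟩
    refine (hb _ fun x => hw.norm_lpPiece_le_of_norm_le hM _ x).trans
      (ENNReal.ofReal_le_ofReal ?_)
    have : (2 : ℝ) ^ (-k : ℤ) * (M * K₀) = M * K₀ * (1 / 2) ^ k := by
      rw [zpow_neg, zpow_natCast, one_div, inv_pow, mul_comm]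
    rw [this, Int.natAbs_neg, Int.natAbs_natCast]
    gcongr
    linarith [mul_nonneg hC0 hK₂]

lemma IsLittlewoodPaleyWindow.memBesov [Nontrivial (EuclideanSpace ℝ (Fin d))]
    (hw : IsLittlewoodPaleyWindow w) (f : 𝓢(EuclideanSpace ℝ (Fin d), ℂ))
    (hf : besovNorm w f < ∞) : MemBesov w f where
  continuous := f.continuous
  growth := by
    obtain ⟨M, -, hM⟩ := f.decay 0 0
    exact ⟨M, 0, fun x => by simpa using hM x⟩
  norm_lt_top := hf
  hasSum_partial := hw.hasSum_weakPartial f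

end BesovNorm

/-! ### Lattice sums of bumps with uniformly bounded Besov norm -/

section Lattice

open ComplexConjugate

/-- The derivative of `g` is globally Lipschitz, with constant `K`, so `t ↦ g(x + ty) + g(x - ty)`
has derivative at most `2K t ‖y‖²`, and `t` runs over `[0, 1]`. -/
lemma ContDiff.exists_norm_second_difference_le {E F : Type*} [NormedAddCommGroup E]
    [NormedSpace ℝ E] [NormedAddCommGroup F] [NormedSpace ℝ F] {g : E → F}
    (hg : ContDiff ℝ 2 g) (hc : HasCompactSupport g) :
    ∃ C : ℝ, 0 ≤ C ∧ ∀ x y, ‖g (x + y) + g (x - y) - (2 : ℝ) • g x‖ ≤ C * ‖y‖ ^ 2 := by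
  obtain ⟨K, hK⟩ := ContDiff.lipschitzWith_of_hasCompactSupport (hc.fderiv ℝ)
    (hg.fderiv_right (m := 1) (by norm_num)) one_ne_zero
  have hd : Differentiable ℝ g := hg.differentiable (by norm_num)
  refine ⟨2 * K, by positivity, fun x y => ?_⟩
  have hder : ∀ t : ℝ, HasDerivAt (fun t : ℝ => g (x + t • y) + g (x - t • y))
      (fderiv ℝ g (x + t • y) y - fderiv ℝ g (x - t • y) y) t := by
    intro t
    have hy : HasDerivAt (fun t : ℝ => t • y) y t := by
      simpa using (hasDerivAt_id t).smul_const y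
    have h1 := (hd (x + t • y)).hasFDerivAt.comp_hasDerivAt t (hy.const_add x)
    have h2 := (hd (x - t • y)).hasFDerivAt.comp_hasDerivAt t (hy.const_sub x)
    have h3 := h1.add h2
    rwa [map_neg, ← sub_eq_add_neg] at h3
  have h := norm_image_sub_le_of_norm_deriv_le_segment_01'
    (C := 2 * K * ‖y‖ ^ 2) (fun t _ => (hder t).hasDerivWithinAt) fun t ht => ?_
  · simpa [two_smul] using h
  · rw [← sub_apply]
    have h3 := hK.norm_sub_le (x + t • y) (x - t • y)
    have h4 : x + t • y - (x - t • y) = (2 * t) • y := by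
      rw [mul_smul, two_smul]; abel
    rw [h4, norm_smul, Real.norm_of_nonneg (by linarith [ht.1])] at h3
    refine (ContinuousLinearMap.le_opNorm _ _).trans ?_
    calc _ ≤ K * (2 * t * ‖y‖) * ‖y‖ := by gcongr
      _ = 2 * K * ‖y‖ ^ 2 * t := by ring
      _ ≤ 2 * K * ‖y‖ ^ 2 * 1 := by gcongr; exact ht.2.le
      _ = _ := mul_one _

section Separated

variable {E ι : Type*} [NormedAddCommGroup E] [Fintype ι] {q : ι → E}

/-- Balls of radius `1/4` about `1/2`-separated points are disjoint. -/
lemma sum_indicator_separated_le (hq : Pairwise fun i j => 1 / 2 ≤ ‖q i - q j‖) (x : E) :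
    ∑ i, (if ‖x - q i‖ < 1 / 4 then 1 else 0 : ℝ) ≤ 1 := by
  classical
  rw [Finset.sum_boole]
  norm_cast
  refine Finset.card_le_one.mpr fun i hi j hj => ?_
  by_contra hij
  have h1 := (Finset.mem_filter.mp hi).2
  have h2 := (Finset.mem_filter.mp hj).2
  have h3 : ‖q i - q j‖ ≤ ‖x - q j‖ + ‖x - q i‖ := by
    simpa using norm_sub_le (x - q j) (x - q i)
  linarith [hq hij]

lemma norm_sum_translates_le (hq : Pairwise fun i j => 1 / 2 ≤ ‖q i - q j‖) {Φ : E → ℂ}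
    (hΦ : ∀ x, 1 / 4 ≤ ‖x‖ → Φ x = 0) {M : ℝ} (hM : ∀ x, ‖Φ x‖ ≤ M) {c : ι → ℂ}
    (hc : ∀ i, ‖c i‖ ≤ 1) (x : E) : ‖∑ i, c i * Φ (x - q i)‖ ≤ M := by
  have hM0 : 0 ≤ M := (norm_nonneg _).trans (hM 0)
  calc _ ≤ ∑ i, M * (if ‖x - q i‖ < 1 / 4 then 1 else 0 : ℝ) := by
        refine norm_sum_le_of_le _ fun i _ => ?_
        split_ifs with h
        · rw [norm_mul, mul_one, ← one_mul M]
          exact mul_le_mul (hc i) (hM _) (norm_nonneg _) zero_le_one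
        · simp [hΦ _ (not_lt.mp h)]
    _ ≤ M * 1 := by
        rw [← Finset.mul_sum]
        gcongr
        exact sum_indicator_separated_le hq x
    _ = M := mul_one M

/-- A translate contributes only if its centre is within `1/4` of `x`, `x + y` or `x - y`. Each of
these points is near at most one centre, whence the factor 3, independent of the number of
translates. -/
lemma norm_second_difference_sum_translates_le
    (hq : Pairwise fun i j => 1 / 2 ≤ ‖q i - q j‖) {Φ : E → ℂ}
    (hΦ : ∀ x, 1 / 4 ≤ ‖x‖ → Φ x = 0) {C : ℝ} (hC0 : 0 ≤ C)
    (hC : ∀ x y, ‖Φ (x + y) + Φ (x - y) - 2 * Φ x‖ ≤ C * ‖y‖ ^ 2) {c : ι → ℂ}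
    (hc : ∀ i, ‖c i‖ ≤ 1) (x y : E) :
    ‖∑ i, c i * Φ (x + y - q i) + ∑ i, c i * Φ (x - y - q i) - 2 * ∑ i, c i * Φ (x - q i)‖ ≤
      3 * C * ‖y‖ ^ 2 := by
  have h1 : ∑ i, c i * Φ (x + y - q i) + ∑ i, c i * Φ (x - y - q i) -
      2 * ∑ i, c i * Φ (x - q i) =
      ∑ i, c i * (Φ (x - q i + y) + Φ (x - q i - y) - 2 * Φ (x - q i)) := by
    rw [Finset.mul_sum, ← Finset.sum_add_distrib, ← Finset.sum_sub_distrib]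
    refine Finset.sum_congr rfl fun i _ => ?_
    rw [sub_add_eq_add_sub, sub_right_comm x (q i) y]
    ring
  have hD : 0 ≤ C * ‖y‖ ^ 2 := by positivity
  set I : E → ι → ℝ := fun x i => if ‖x - q i‖ < 1 / 4 then 1 else 0 with hI
  have hI0 : ∀ x i, 0 ≤ I x i := fun x i => by simp only [hI]; split_ifs <;> norm_num
  have hI1 : ∀ x i, ‖x - q i‖ < 1 / 4 → I x i = 1 := fun x i h => if_pos h
  rw [h1]
  calc _ ≤ ∑ i, C * ‖y‖ ^ 2 * (I x i + I (x + y) i + I (x - y) i) := by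
        refine norm_sum_le_of_le _ fun i _ => ?_
        by_cases h : 1 ≤ I x i + I (x + y) i + I (x - y) i
        · rw [norm_mul]
          calc _ ≤ 1 * (C * ‖y‖ ^ 2) :=
                mul_le_mul (hc i) (hC _ _) (norm_nonneg _) zero_le_one
            _ ≤ _ := by rw [one_mul]; exact le_mul_of_one_le_right hD h
        · have h0 : ∀ z, (z = x ∨ z = x + y ∨ z = x - y) → Φ (z - q i) = 0 := by
            intro z hz
            refine hΦ _ (not_lt.mp fun hlt => h ?_)
            have := hI1 z i hlt
            have h2 := hI0 x i
            have h3 := hI0 (x + y) i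
            have h4 := hI0 (x - y) i
            rcases hz with rfl | rfl | rfl <;> linarith
          rw [sub_add_eq_add_sub, sub_right_comm x (q i) y, h0 _ (Or.inl rfl),
            h0 _ (Or.inr (Or.inl rfl)), h0 _ (Or.inr (Or.inr rfl))]
          have h2 := hI0 x i
          have h3 := hI0 (x + y) i
          have h4 := hI0 (x - y) i
          simp only [mul_zero, add_zero, sub_zero, norm_zero]
          positivity
    _ ≤ C * ‖y‖ ^ 2 * (1 + 1 + 1) := by
        rw [← Finset.mul_sum, Finset.sum_add_distrib, Finset.sum_add_distrib]
        gcongr <;> exact sum_indicator_separated_le hq _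
    _ = _ := by ring

end Separated

/-- A smooth cut-off function on the plane, supported in the ball of radius `1/4`. -/
def planeCutoff : ContDiffBump (0 : EuclideanSpace ℝ (Fin 2)) where
  rIn := 1 / 8
  rOut := 1 / 4
  rIn_pos := by norm_num
  rIn_lt_rOut := by norm_num

lemma hasCompactSupport_coord_mul_planeCutoff : HasCompactSupport
    fun x : EuclideanSpace ℝ (Fin 2) => ((x 0 * planeCutoff x : ℝ) : ℂ) :=
  (planeCutoff.hasCompactSupport.mul_left
    (f := fun x : EuclideanSpace ℝ (Fin 2) => x 0)).comp_left Complex.ofReal_zero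

/-- A smooth function on the plane, supported in the ball of radius `1/4`, which is equal to the
first coordinate near the origin. -/
def coordBump : 𝓢(EuclideanSpace ℝ (Fin 2), ℂ) :=
  hasCompactSupport_coord_mul_planeCutoff.toSchwartzMap
    (Complex.ofRealCLM.contDiff.comp ((EuclideanSpace.proj (𝕜 := ℝ) (0 : Fin 2)).contDiff.mul
      planeCutoff.contDiff))

lemma coordBump_apply (x : EuclideanSpace ℝ (Fin 2)) :
    coordBump x = ((x 0 * planeCutoff x : ℝ) : ℂ) := rfl

lemma hasCompactSupport_coordBump : HasCompactSupport coordBump :=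
  hasCompactSupport_coord_mul_planeCutoff

lemma coordBump_eq_zero {x : EuclideanSpace ℝ (Fin 2)} (hx : 1 / 4 ≤ ‖x‖) : coordBump x = 0 := by
  have : planeCutoff x = 0 :=
    planeCutoff.zero_of_le_dist (by rw [dist_zero_right]; exact hx)
  simp [coordBump_apply, this]

lemma coordBump_eq_zero_of_coord {x : EuclideanSpace ℝ (Fin 2)} (hx : x 0 = 0) :
    coordBump x = 0 := by
  simp [coordBump_apply, hx]

lemma coordBump_eq_coord {x : EuclideanSpace ℝ (Fin 2)} (hx : ‖x‖ ≤ 1 / 8) :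
    coordBump x = x 0 := by
  have : planeCutoff x = 1 :=
    planeCutoff.one_of_mem_closedBall (by rw [mem_closedBall_zero_iff]; exact hx)
  simp [coordBump_apply, this]

/-- The points `(j + 1, k + 1)`, `0 ≤ j, k < N`, of the integer lattice. -/
def latticePoint {N : ℕ} (i : Fin N × Fin N) : EuclideanSpace ℝ (Fin 2) :=
  !₂[(i.1 : ℝ) + 1, (i.2 : ℝ) + 1]

@[simp]
lemma latticePoint_zero {N : ℕ} (i : Fin N × Fin N) : latticePoint i 0 = (i.1 : ℝ) + 1 := rfl

@[simp]
lemma latticePoint_one {N : ℕ} (i : Fin N × Fin N) : latticePoint i 1 = (i.2 : ℝ) + 1 := rfl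

/-- The superposition of translates of `coordBump` centred at the lattice points. -/
def latticeSum {N : ℕ} (c : Fin N → Fin N → ℂ) : 𝓢(EuclideanSpace ℝ (Fin 2), ℂ) :=
  ∑ i : Fin N × Fin N, c i.1 i.2 •
    SchwartzMap.compSubConstCLM ℂ (latticePoint i) coordBump

lemma latticeSum_apply {N : ℕ} (c : Fin N → Fin N → ℂ) (x : EuclideanSpace ℝ (Fin 2)) :
    latticeSum c x =
      ∑ i : Fin N × Fin N, c i.1 i.2 * coordBump (x - latticePoint i) := by
  simp [latticeSum]

lemma abs_coord_le_norm (x : EuclideanSpace ℝ (Fin 2)) (i : Fin 2) : |x i| ≤ ‖x‖ := by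
  simpa using PiLp.norm_apply_le x i

lemma one_le_abs_intCast {m : ℤ} (hm : m ≠ 0) : (1 : ℝ) ≤ |(m : ℝ)| := by
  exact_mod_cast Int.one_le_abs hm

lemma one_le_abs_natCast_sub {m n : ℕ} (h : m ≠ n) : (1 : ℝ) ≤ |(m : ℝ) - n| := by
  simpa using one_le_abs_intCast (m := (m : ℤ) - n) (by lia)

lemma pairwise_lattice_separated (N : ℕ) :
    Pairwise fun i j : Fin N × Fin N => 1 / 2 ≤
      ‖latticePoint i - latticePoint j‖ := by
  intro i j hij
  have h := abs_coord_le_norm (latticePoint i - latticePoint j)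
  have h0 := h 0
  have h1 := h 1
  simp only [PiLp.sub_apply, latticePoint_zero, latticePoint_one,
    add_sub_add_right_eq_sub] at h0 h1
  by_cases h2 : (i.1 : ℕ) = j.1
  · have h3 : (i.2 : ℕ) ≠ j.2 := fun h3 => hij (Prod.ext (Fin.ext h2) (Fin.ext h3))
    linarith [one_le_abs_natCast_sub h3]
  · linarith [one_le_abs_natCast_sub h2]

/-- A bump centred on the line vanishes there because its coordinate factor does; every other centre
is at distance at least 1. This makes `f(A₂, B) = 0`, and `m = 0` gives one of the two axes. -/
lemma latticeSum_intCast_left {N : ℕ} (c : Fin N → Fin N → ℂ) (m : ℤ) (y : ℝ) :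
    latticeSum c !₂[(m : ℝ), y] = 0 := by
  rw [latticeSum_apply]
  refine Finset.sum_eq_zero fun i _ => mul_eq_zero_of_right _ ?_
  by_cases h : m - (i.1 + 1) = 0
  · refine coordBump_eq_zero_of_coord ?_
    have : (m : ℝ) - (i.1 + 1) = 0 := by exact_mod_cast h
    simpa using this
  · refine coordBump_eq_zero ?_
    have h0 := abs_coord_le_norm (!₂[(m : ℝ), y] - latticePoint i) 0
    have h1 := one_le_abs_intCast h
    push_cast at h1
    simp only [PiLp.sub_apply, Matrix.cons_val_zero, latticePoint_zero] at h0
    linarith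

/-- The lattice starts at height 1, so no bump meets this axis. Vanishing on both axes removes the
eigenvalue 0 from the double operator integral. -/
lemma latticeSum_zero_right {N : ℕ} (c : Fin N → Fin N → ℂ) (x : ℝ) :
    latticeSum c !₂[x, 0] = 0 := by
  rw [latticeSum_apply]
  refine Finset.sum_eq_zero fun i _ => mul_eq_zero_of_right _ (coordBump_eq_zero ?_)
  have h0 := abs_coord_le_norm (!₂[x, 0] - latticePoint i) 1
  have h1 : (0 : ℝ) ≤ i.2 := Nat.cast_nonneg _
  simp only [PiLp.sub_apply, Matrix.cons_val_one, latticePoint_one, Matrix.cons_val_zero, zero_sub, abs_neg] at h0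
  linarith [le_abs_self ((i.2 : ℝ) + 1)]

lemma latticeSum_near_lattice {N : ℕ} (c : Fin N → Fin N → ℂ) (j k : Fin N) {ε : ℝ}
    (hε : |ε| ≤ 1 / 8) :
    latticeSum c !₂[(j : ℝ) + 1 + ε, (k : ℝ) + 1] = c j k * ε := by
  have hn : ‖!₂[(j : ℝ) + 1 + ε, (k : ℝ) + 1] - latticePoint (j, k)‖ ≤ 1 / 8 := by
    rw [EuclideanSpace.norm_eq]
    simpa [Fin.sum_univ_two, Real.sqrt_sq_eq_abs] using hε
  rw [latticeSum_apply, Finset.sum_eq_single (j, k)]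
  · rw [coordBump_eq_coord hn]
    simp
  · intro i _ hi
    refine mul_eq_zero_of_right _ (coordBump_eq_zero ?_)
    have h1 : 1 / 2 ≤ ‖latticePoint i - latticePoint (j, k)‖ := pairwise_lattice_separated N hi
    have h2 := norm_sub_le_norm_sub_add_norm_sub (latticePoint i)
      !₂[(j : ℝ) + 1 + ε, (k : ℝ) + 1] (latticePoint (j, k))
    rw [norm_sub_rev _ !₂[(j : ℝ) + 1 + ε, (k : ℝ) + 1]] at h2
    linarith
  · simp

/-- Arbitrary unimodular increments on the lattice are realized by functions of norm `1` in
`B^1_{∞,1}(ℝ²)`, up to a factor bounded away from zero. -/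
lemma IsLittlewoodPaleyWindow.exists_memBesov_lattice {w : ℝ → ℝ}
    (hw : IsLittlewoodPaleyWindow w) :
    ∃ κ : ℝ, 0 < κ ∧ ∀ (N : ℕ) (_ : 0 < N) (c : Fin N → Fin N → ℂ), (∀ j k, ‖c j k‖ = 1) →
      ∃ (f : EuclideanSpace ℝ (Fin 2) → ℂ) (γ : ℝ), κ ≤ γ ∧ MemBesov w f ∧ besovNorm w f = 1 ∧
        (∀ (m : ℤ) (y : ℝ), f !₂[(m : ℝ), y] = 0) ∧ (∀ x : ℝ, f !₂[x, 0] = 0) ∧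
        ∀ (j k : Fin N) (ε : ℝ), |ε| ≤ 1 / 8 →
          f !₂[(j : ℝ) + 1 + ε, (k : ℝ) + 1] = (γ * ε : ℝ) * c j k := by
  obtain ⟨C, hC0, hC⟩ := ContDiff.exists_norm_second_difference_le
    (coordBump.smooth 2) hasCompactSupport_coordBump
  replace hC : ∀ x y, ‖coordBump (x + y) + coordBump (x - y) - 2 * coordBump x‖ ≤
      C * ‖y‖ ^ 2 := by simpa using hC
  obtain ⟨M, hM0, hM⟩ := coordBump.decay 0 0
  simp only [pow_zero, one_mul, norm_iteratedFDeriv_zero] at hM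
  obtain ⟨K, hK⟩ := hw.exists_besovNorm_le 2 hM0.le (C := 3 * C) (by positivity)
  have hK1 : 0 < max K 1 := by positivity
  -- `K` does not depend on `N` or `c`; the maximum with 1 makes it positive. The normalizing factor
  -- `γ` below is the inverse of a norm at most `K`.
  refine ⟨(max K 1)⁻¹, by positivity, fun N hN c hc => ?_⟩
  set g := latticeSum c
  have hg : besovNorm w g ≤ ENNReal.ofReal K := by
    refine hK g (fun x => ?_) fun x y => ?_
    · rw [latticeSum_apply]
      exact norm_sum_translates_le (pairwise_lattice_separated N)
        (fun _ => coordBump_eq_zero) hM (fun i => (hc i.1 i.2).le) x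
    · simp only [g, latticeSum_apply]
      exact norm_second_difference_sum_translates_le (pairwise_lattice_separated N)
        (fun _ => coordBump_eq_zero) hC0 hC (fun i => (hc i.1 i.2).le) x y
  have hg0 : g ≠ 0 := by
    intro h0
    have h1 := latticeSum_near_lattice c ⟨0, hN⟩ ⟨0, hN⟩ (ε := 1 / 8) (by norm_num)
    have h2 : c ⟨0, hN⟩ ⟨0, hN⟩ ≠ 0 := fun h => by simpa [h] using hc ⟨0, hN⟩ ⟨0, hN⟩
    rw [show latticeSum c = 0 from h0] at h1
    simp [h2] at h1
  have hgtop : besovNorm w g < ∞ := hg.trans_lt ENNReal.ofReal_lt_top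
  have hgpos : 0 < (besovNorm w g).toReal :=
    ENNReal.toReal_pos (hw.besovNorm_ne_zero hg0) hgtop.ne
  set γ := ((besovNorm w g).toReal)⁻¹
  have hγ : 0 < γ := inv_pos.mpr hgpos
  have hnorm : besovNorm w (((γ : ℂ) • g : 𝓢(EuclideanSpace ℝ (Fin 2), ℂ)) :
      EuclideanSpace ℝ (Fin 2) → ℂ) = 1 := by
    have h1 := besovNorm_const_mul (w := w) (γ : ℂ) g
    have h2 : ‖(γ : ℂ)‖ₑ = (besovNorm w g)⁻¹ := by
      rw [← ofReal_norm, Complex.norm_of_nonneg hγ.le, ENNReal.ofReal_inv_of_pos hgpos,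
        ENNReal.ofReal_toReal hgtop.ne]
    rw [h2, ENNReal.inv_mul_cancel (hw.besovNorm_ne_zero hg0) hgtop.ne] at h1
    exact h1
  refine ⟨((γ : ℂ) • g : 𝓢(EuclideanSpace ℝ (Fin 2), ℂ)), γ, ?_,
    hw.memBesov _ (by rw [hnorm]; exact ENNReal.one_lt_top), hnorm, fun m y => ?_, fun x => ?_,
    fun j k ε hε => ?_⟩
  · refine inv_anti₀ hgpos (ENNReal.toReal_le_of_le_ofReal hK1.le (hg.trans ?_))
    exact ENNReal.ofReal_le_ofReal (le_max_left _ _)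
  · simp [g, latticeSum_intCast_left]
  · simp [g, latticeSum_zero_right]
  · rw [smul_apply, latticeSum_near_lattice c j k hε, smul_eq_mul]
    push_cast
    ring

end Lattice

/-! ### Functions of diagonal operators of finite rank -/

section Operators

open InnerProductSpace ComplexConjugate

variable {H : Type*} [NormedAddCommGroup H] [InnerProductSpace ℂ H]
variable {ι κ : Type*} [Fintype ι] [Fintype κ]

/-- The operator which is diagonal in the orthonormal system `u`, with eigenvalues `a`, and
vanishes on the orthogonal complement of the system. -/
def diagOp (u : ι → H) (a : ι → ℝ) : H →L[ℂ] H :=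
  ∑ i, (a i : ℂ) • rankOne ℂ (u i) (u i)

lemma diagOp_apply (u : ι → H) (a : ι → ℝ) (v : H) :
    diagOp u a v = ∑ i, ((a i : ℂ) * inner ℂ (u i) v) • u i := by
  simp only [diagOp, sum_apply, smul_apply, rankOne_apply, smul_smul]

lemma diagOp_sub (u : ι → H) (a b : ι → ℝ) : diagOp u a - diagOp u b = diagOp u (a - b) := by
  simp [diagOp, ← Finset.sum_sub_distrib, sub_smul]

lemma inner_diagOp_left (u : ι → H) (a : ι → ℝ) (v z : H) :
    inner ℂ (diagOp u a v) z = inner ℂ v (diagOp u a z) := by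
  simp only [diagOp_apply, sum_inner, inner_sum, inner_smul_left, inner_smul_right, map_mul,
    Complex.conj_ofReal, inner_conj_symm]
  exact Finset.sum_congr rfl fun i _ => by ring

lemma inner_diagOp {u : ι → H} (hu : Orthonormal ℂ u) (a : ι → ℝ) (i : ι) (z : H) :
    inner ℂ (u i) (diagOp u a z) = a i * inner ℂ (u i) z := by
  rw [diagOp_apply, hu.inner_right_fintype]

lemma range_diagOp_le (u : ι → H) (a : ι → ℝ) :
    LinearMap.range (diagOp u a : H →ₗ[ℂ] H) ≤ Submodule.span ℂ (Set.range u) := by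
  rintro _ ⟨v, rfl⟩
  rw [ContinuousLinearMap.coe_coe, diagOp_apply]
  exact Submodule.sum_mem _ fun i _ =>
    Submodule.smul_mem _ _ (Submodule.subset_span (Set.mem_range_self i))

lemma mem_ker_sub_smul_id (A : H →L[ℂ] H) (c : ℂ) (z : H) :
    z ∈ (A - c • ContinuousLinearMap.id ℂ H).ker ↔ A z = c • z := by
  change A z - c • z = 0 ↔ _
  exact sub_eq_zero

variable [CompleteSpace H]

lemma isFiniteRankSelfAdjoint_diagOp (u : ι → H) (a : ι → ℝ) :
    IsFiniteRankSelfAdjoint (diagOp u a) where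
  isSelfAdjoint := by
    rw [ContinuousLinearMap.isSelfAdjoint_iff_isSymmetric]
    exact fun v z => inner_diagOp_left u a v z
  finiteRank := by
    have := FiniteDimensional.span_of_finite ℂ (Set.finite_range u)
    exact Submodule.finiteDimensional_of_le (range_diagOp_le u a)

/-- The eigenvalue 0 is excluded because its eigenspace contains the whole orthogonal complement of
the system. For `x ≠ 0`, the right side maps into the eigenspace, is symmetric and fixes every
eigenvector, hence is the orthogonal projection. -/
lemma spectralAtom_diagOp [DecidableEq ℝ] {u : ι → H} (hu : Orthonormal ℂ u) (a : ι → ℝ) {x : ℝ}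
    (hx : x ≠ 0) :
    spectralAtom (diagOp u a) x = diagOp u fun i => if a i = x then 1 else 0 := by
  have hx' : (x : ℂ) ≠ 0 := Complex.ofReal_ne_zero.mpr hx
  ext v
  refine Submodule.eq_starProjection_of_mem_of_inner_eq_zero ?_ fun z hz => ?_
  · rw [mem_ker_sub_smul_id, diagOp_apply u a]
    simp only [inner_diagOp hu]
    rw [diagOp_apply, Finset.smul_sum]
    refine Finset.sum_congr rfl fun i _ => ?_
    split_ifs with h <;> simp [h, smul_smul]
  · rw [mem_ker_sub_smul_id] at hz
    have h1 : ∀ i, a i ≠ x → inner ℂ (u i) z = 0 := by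
      intro i hi
      have h2 := inner_diagOp hu a i z
      rw [hz, inner_smul_right] at h2
      have h3 : ((x : ℂ) - a i) * inner ℂ (u i) z = 0 := by rw [sub_mul, h2, sub_self]
      refine (mul_eq_zero.mp h3).resolve_left (sub_ne_zero.mpr ?_)
      exact_mod_cast hi.symm
    have h2 : diagOp u (fun i => if a i = x then 1 else 0) z = z := by
      refine smul_right_injective H hx' ?_
      simp only
      rw [← hz, diagOp_apply, diagOp_apply, Finset.smul_sum]
      refine Finset.sum_congr rfl fun i _ => ?_
      by_cases h : a i = x
      · simp [h, smul_smul]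
      · simp [h1 i h]
    rw [inner_sub_left, inner_diagOp_left, h2, sub_self]

lemma norm_diagOp_const_le {u : ι → H} (hu : Orthonormal ℂ u) (ε : ℝ) :
    ‖diagOp u fun _ => ε‖ ≤ |ε| := by
  classical
  have h1 : diagOp u (fun _ => ε) = (ε : ℂ) • spectralAtom (diagOp u fun _ => 1) 1 := by
    rw [spectralAtom_diagOp hu _ one_ne_zero]
    simp [diagOp, Finset.smul_sum]
  rw [h1, norm_smul, Complex.norm_real, Real.norm_eq_abs]
  exact mul_le_of_le_one_right (abs_nonneg _) (Submodule.starProjection_norm_le _)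

lemma finsum_sum_ite_eq {M : Type*} [AddCommMonoid M] [DecidableEq ℝ] (b : κ → ℝ)
    (g : κ → M) : ∑ᶠ y : ℝ, ∑ j, (if b j = y then g j else 0) = ∑ j, g j := by
  rw [finsum_sum_comm]
  · refine Finset.sum_congr rfl fun j _ => ?_
    rw [finsum_eq_single _ (b j) fun y hy => if_neg hy.symm, if_pos rfl]
  · intro j _
    refine (Set.finite_singleton (b j)).subset fun y hy => ?_
    by_contra h
    exact hy (if_neg fun h' => h h'.symm)

/-- Since `f` vanishes on the axes, the atoms at 0 carry no weight. Repeated eigenvalues are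
harmless: each atom is the sum of the rank-one projections with that eigenvalue. -/
lemma opFun_diagOp {u : ι → H} (hu : Orthonormal ℂ u) {v : κ → H} (hv : Orthonormal ℂ v)
    (a : ι → ℝ) (b : κ → ℝ) {f : EuclideanSpace ℝ (Fin 2) → ℂ}
    (hf : ∀ x : ℝ, f !₂[x, 0] = 0) (hf' : ∀ y : ℝ, f !₂[0, y] = 0) :
    opFun f (diagOp u a) (diagOp v b) =
      ∑ i, ∑ j, f !₂[a i, b j] • (rankOne ℂ (u i) (u i) ∘L rankOne ℂ (v j) (v j)) := by
  classical
  have h : ∀ x y : ℝ, f !₂[x, y] • (spectralAtom (diagOp u a) x ∘L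
      ContinuousLinearMap.id ℂ H ∘L spectralAtom (diagOp v b) y) =
      ∑ j, if b j = y then ∑ i, (if a i = x then
        f !₂[a i, b j] • (rankOne ℂ (u i) (u i) ∘L rankOne ℂ (v j) (v j)) else 0) else 0 := by
    intro x y
    have h0 : f !₂[x, y] = 0 ∨ (x ≠ 0 ∧ y ≠ 0) := by
      by_cases hx : x = 0
      · left; rw [hx, hf']
      · by_cases hy : y = 0
        · left; rw [hy, hf]
        · exact Or.inr ⟨hx, hy⟩
    rcases h0 with h0 | ⟨hx, hy⟩
    · rw [h0, zero_smul]
      refine (Finset.sum_eq_zero fun j _ => ?_).symm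
      split_ifs with hj
      · refine Finset.sum_eq_zero fun i _ => ?_
        split_ifs with hi
        · rw [hi, hj, h0, zero_smul]
        · rfl
      · rfl
    · rw [spectralAtom_diagOp hu a hx, spectralAtom_diagOp hv b hy, ContinuousLinearMap.id_comp]
      ext z
      simp only [smul_apply, ContinuousLinearMap.comp_apply, diagOp, sum_apply, map_sum,
        Finset.smul_sum]
      refine Finset.sum_congr rfl fun j _ => ?_
      split_ifs with hj
      · rw [sum_apply]
        refine Finset.sum_congr rfl fun i _ => ?_
        split_ifs with hi <;> simp [hi, hj]
      · simp
  simp only [opFun, doubleOpIntegral, h, finsum_sum_ite_eq]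
  rw [← finsum_sum_ite_eq a]
  refine finsum_congr fun x => ?_
  rw [Finset.sum_comm]
  exact Finset.sum_congr rfl fun i _ => by split_ifs <;> simp

end Operators

/-! ### The Fourier matrix -/

section FlatMatrix

open ComplexConjugate

/-- The Fourier matrix: a unimodular matrix with orthogonal columns. -/
lemma exists_unimodular_orthogonal (N : ℕ) :
    ∃ c : Fin N → Fin N → ℂ, (∀ i j, ‖c i j‖ = 1) ∧
      ∀ j k, ∑ i, c i j * conj (c i k) = if j = k then (N : ℂ) else 0 := by
  rcases Nat.eq_zero_or_pos N with rfl | hN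
  · exact ⟨fun _ _ => 1, by simp, fun j => j.elim0⟩
  set ω := Complex.exp (2 * Real.pi * Complex.I / N)
  have hω : IsPrimitiveRoot ω N := Complex.isPrimitiveRoot_exp N hN.ne'
  have hω1 : ‖ω‖ = 1 := hω.norm'_eq_one hN.ne'
  have hω0 : ω ≠ 0 := norm_ne_zero_iff.mp (by simp [hω1])
  refine ⟨fun i j => ω ^ ((i : ℕ) * j), fun i j => by simp [hω1], fun j k => ?_⟩
  have hconj : ∀ m : ℕ, conj (ω ^ m) = (ω ^ m)⁻¹ := fun m =>
    (Complex.inv_eq_conj (by simp [hω1])).symm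
  have h1 : ∀ i : Fin N, ω ^ ((i : ℕ) * j) * conj (ω ^ ((i : ℕ) * k)) =
      (ω ^ (j : ℕ) / ω ^ (k : ℕ)) ^ (i : ℕ) := by
    intro i
    rw [hconj, div_pow, ← pow_mul, ← pow_mul, mul_comm (i : ℕ) j, mul_comm (i : ℕ) k,
      div_eq_mul_inv]
  simp only [h1]
  split_ifs with h
  · simp [h, hω0]
  -- Off the diagonal this is a full geometric sum whose ratio is an `N`-th root of unity different
  -- from 1.
  · rw [Fin.sum_univ_eq_sum_range fun i => (ω ^ (j : ℕ) / ω ^ (k : ℕ)) ^ i]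
    have h2 : ω ^ (j : ℕ) / ω ^ (k : ℕ) ≠ 1 := by
      rw [Ne, div_eq_one_iff_eq (pow_ne_zero _ hω0)]
      exact fun h' => h (Fin.ext (hω.pow_inj j.2 k.2 h'))
    have h3 : (ω ^ (j : ℕ) / ω ^ (k : ℕ)) ^ N = 1 := by
      rw [div_pow, ← pow_mul, ← pow_mul, mul_comm (j : ℕ), mul_comm (k : ℕ), pow_mul, pow_mul,
        hω.pow_eq_one]
      simp
    have h4 := geom_sum_mul (ω ^ (j : ℕ) / ω ^ (k : ℕ)) N
    rw [h3, sub_self] at h4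
    exact (mul_eq_zero.mp h4).resolve_right (sub_ne_zero.mpr h2)

end FlatMatrix

/-! ### Phase cancellation and the growth `√N` -/

section LowerBound

open InnerProductSpace ComplexConjugate

variable {H : Type*} [NormedAddCommGroup H] [InnerProductSpace ℂ H]

lemma exists_orthonormal_fin (hH : ¬ FiniteDimensional ℂ H) (N : ℕ) :
    ∃ u : Fin N → H, Orthonormal ℂ u := by
  have hrank : (N : Cardinal) ≤ Module.rank ℂ H := by
    have h : Cardinal.aleph0 ≤ Module.rank ℂ H := by
      rw [← not_lt, Module.rank_lt_aleph0_iff]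
      exact hH
    exact (Cardinal.natCast_lt_aleph0.le).trans h
  obtain ⟨g, hg⟩ := exists_linearIndependent_of_le_rank hrank
  exact ⟨_, gramSchmidtNormed_orthonormal hg⟩

lemma norm_sum_orthonormal {ι : Type*} [Fintype ι] {u : ι → H} (hu : Orthonormal ℂ u) :
    ‖∑ i, u i‖ = √(Fintype.card ι) := by
  classical
  have h := hu.inner_sum (fun _ => 1) (fun _ => 1) Finset.univ
  simp only [one_smul, map_one, mul_one, Finset.sum_const, Finset.card_univ, nsmul_eq_mul] at h
  rw [norm_eq_sqrt_re_inner (𝕜 := ℂ), h]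
  simp

/-- The orthonormal system obtained from `u` by means of the unitary matrix `N^{-1/2} c̄`. -/
def rotatedSystem {N : ℕ} (c : Fin N → Fin N → ℂ) (u : Fin N → H) (j : Fin N) : H :=
  ∑ i, ((√N : ℝ) : ℂ)⁻¹ • conj (c i j) • u i

variable {N : ℕ} {c : Fin N → Fin N → ℂ} {u : Fin N → H}

lemma inner_rotatedSystem (hu : Orthonormal ℂ u) (i j : Fin N) :
    inner ℂ (u i) (rotatedSystem c u j) = ((√N : ℝ) : ℂ)⁻¹ * conj (c i j) := by
  simp only [rotatedSystem, smul_smul]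
  rw [hu.inner_right_fintype]

lemma orthonormal_rotatedSystem (hN : 0 < N) (hu : Orthonormal ℂ u)
    (hc : ∀ j k, ∑ i, c i j * conj (c i k) = if j = k then (N : ℂ) else 0) :
    Orthonormal ℂ (rotatedSystem c u) := by
  rw [orthonormal_iff_ite]
  intro j k
  have hs : ((√N : ℝ) : ℂ) * (√N : ℝ) = N := by
    rw [← Complex.ofReal_mul, Real.mul_self_sqrt (Nat.cast_nonneg N), Complex.ofReal_natCast]
  have hN' : (N : ℂ) ≠ 0 := by exact_mod_cast hN.ne'
  have h : inner ℂ (rotatedSystem c u j) (rotatedSystem c u k) =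
      (N : ℂ)⁻¹ * ∑ i, c i j * conj (c i k) := by
    conv_lhs => rw [rotatedSystem]
    simp only [sum_inner, inner_smul_left, inner_rotatedSystem hu, map_inv₀, Complex.conj_ofReal,
      Complex.conj_conj]
    rw [← hs, mul_inv, Finset.mul_sum]
    exact Finset.sum_congr rfl fun i _ => by ring
  rw [h, hc]
  split_ifs
  · exact inv_mul_cancel₀ hN'
  · exact mul_zero _

/-- In each term `c_ij` meets `⟨u_i, v_j⟩ = N^{-1/2} conj c_ij`, and the phases cancel. The test
vector `∑ v_k` is thus sent to `t √N ∑ u_i`, which is `t √N` times longer. -/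
lemma le_norm_sum_rankOne_comp_rankOne (hN : 0 < N) (hu : Orthonormal ℂ u)
    (hc1 : ∀ i j, ‖c i j‖ = 1)
    (hc : ∀ j k, ∑ i, c i j * conj (c i k) = if j = k then (N : ℂ) else 0) {t : ℝ} (ht : 0 ≤ t) :
    t * √N ≤ ‖∑ i, ∑ j, ((t : ℂ) * c i j) • (rankOne ℂ (u i) (u i) ∘L
      rankOne ℂ (rotatedSystem c u j) (rotatedSystem c u j))‖ := by
  set v := rotatedSystem c u with hv'
  have hv : Orthonormal ℂ v := orthonormal_rotatedSystem hN hu hc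
  have hsN : 0 < √(N : ℝ) := Real.sqrt_pos.mpr (by exact_mod_cast hN)
  have hs : ((√N : ℝ) : ℂ)⁻¹ * N = (√N : ℝ) := by
    rw [← Complex.ofReal_inv, ← Complex.ofReal_natCast, ← Complex.ofReal_mul]
    congr 1
    rw [inv_mul_eq_div, Real.div_sqrt]
  set T := ∑ i, ∑ j, ((t : ℂ) * c i j) • (rankOne ℂ (u i) (u i) ∘L rankOne ℂ (v j) (v j))
  have h1 : ∀ j, inner ℂ (v j) (∑ k, v k) = 1 := by
    intro j
    simpa only [one_smul] using hv.inner_right_fintype (fun _ => 1) j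
  have hT : T (∑ k, v k) = ((t * √N : ℝ) : ℂ) • ∑ i, u i := by
    simp only [T, sum_apply, smul_apply, ContinuousLinearMap.comp_apply, rankOne_apply, h1,
      one_smul]
    rw [Finset.smul_sum]
    refine Finset.sum_congr rfl fun i _ => ?_
    have h2 : ∀ j, ((t : ℂ) * c i j) • inner ℂ (u i) (v j) • u i =
        ((t : ℂ) * ((√N : ℝ) : ℂ)⁻¹) • u i := by
      intro j
      have h3 : c i j * conj (c i j) = 1 := by
        rw [Complex.mul_conj, Complex.normSq_eq_norm_sq, hc1]; simp
      rw [hv', inner_rotatedSystem hu, smul_smul]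
      congr 1
      linear_combination (t : ℂ) * ((√N : ℝ) : ℂ)⁻¹ * h3
    simp only [h2, Finset.sum_const, Finset.card_univ, Fintype.card_fin, ← Nat.cast_smul_eq_nsmul ℂ,
      smul_smul]
    congr 1
    rw [Complex.ofReal_mul]
    linear_combination (t : ℂ) * hs
  have h4 := T.le_opNorm (∑ k, v k)
  rw [hT, norm_smul, norm_sum_orthonormal hu, norm_sum_orthonormal hv, Fintype.card_fin,
    Complex.norm_of_nonneg (by positivity)] at h4
  exact le_of_mul_le_mul_right h4 hsN

end LowerBound

/-! ### Comparison of Schatten and operator norms -/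

section Schatten

variable {H : Type*} [NormedAddCommGroup H] [InnerProductSpace ℂ H]

lemma singularNumber_le_enorm (j : ℕ) (T : H →L[ℂ] H) : singularNumber j T ≤ ‖T‖ₑ := by
  refine (iInf₂_le 0 ?_).trans (by simp)
  simp [LinearMap.rank_zero]

lemma enorm_le_singularNumber_zero (T : H →L[ℂ] H) : ‖T‖ₑ ≤ singularNumber 0 T := by
  refine le_iInf₂ fun K hK => ?_
  have h : LinearMap.rank (K : H →ₗ[ℂ] H) = 0 := by simpa using hK
  rw [LinearMap.rank, Submodule.rank_eq_zero, LinearMap.range_eq_bot] at h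
  have hK0 : K = 0 := ContinuousLinearMap.coe_injective h
  rw [hK0, sub_zero]

lemma singularNumber_eq_zero {j : ℕ} {T : H →L[ℂ] H}
    (hT : LinearMap.rank (T : H →ₗ[ℂ] H) ≤ j) : singularNumber j T = 0 :=
  le_antisymm ((iInf₂_le T hT).trans (by simp [← ofReal_norm])) bot_le

lemma enorm_le_schattenNorm {p : ℝ} (hp : 0 < p) (T : H →L[ℂ] H) : ‖T‖ₑ ≤ schattenNorm p T := by
  rw [schattenNorm, one_div, ENNReal.le_rpow_inv_iff hp]
  exact (ENNReal.rpow_le_rpow (enorm_le_singularNumber_zero T) hp.le).trans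
    (ENNReal.le_tsum (f := fun j => singularNumber j T ^ p) 0)

/-- Only the first `N` singular values can be nonzero, and each is at most the operator norm. -/
lemma schattenNorm_le_of_rank_le {p : ℝ} (hp : 0 < p) {N : ℕ} {T : H →L[ℂ] H}
    (hT : LinearMap.rank (T : H →ₗ[ℂ] H) ≤ N) :
    schattenNorm p T ≤ (N : ℝ≥0∞) ^ (1 / p) * ‖T‖ₑ := by
  have h : ∑' j : ℕ, singularNumber j T ^ p ≤ N * ‖T‖ₑ ^ p := by
    rw [tsum_eq_sum (s := Finset.range N)]
    · refine (Finset.sum_le_card_nsmul _ _ (‖T‖ₑ ^ p) fun j _ =>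
        ENNReal.rpow_le_rpow (singularNumber_le_enorm j T) hp.le).trans (by simp)
    · intro j hj
      have hj' : N ≤ j := by simpa using hj
      rw [singularNumber_eq_zero (hT.trans (by exact_mod_cast hj')), ENNReal.zero_rpow_of_pos hp]
  calc schattenNorm p T ≤ (N * ‖T‖ₑ ^ p) ^ (1 / p) := ENNReal.rpow_le_rpow h (by positivity)
    _ = _ := by
      rw [ENNReal.mul_rpow_of_nonneg _ _ (by positivity), ← ENNReal.rpow_mul,
        mul_one_div_cancel hp.ne', ENNReal.rpow_one]

lemma rank_diagOp_le {N : ℕ} (u : Fin N → H) (a : Fin N → ℝ) :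
    LinearMap.rank (diagOp u a : H →ₗ[ℂ] H) ≤ N := by
  classical
  refine (Submodule.rank_mono (range_diagOp_le u a)).trans ?_
  rw [← Set.image_univ, ← Finset.coe_univ, ← Finset.coe_image]
  refine (rank_span_finset_le _).trans ?_
  exact_mod_cast Finset.card_image_le.trans (by simp)

end Schatten

/-! ### The counterexample and the choice of exponents -/

section Counterexample

open InnerProductSpace ComplexConjugate

variable {H : Type*} [NormedAddCommGroup H] [InnerProductSpace ℂ H] [CompleteSpace H]

/-- Functions of norm `1` in `B^1_{∞,1}(ℝ²)` and finite rank operators for which a perturbation of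
norm at most `ε` and rank at most `N` changes `f(A, B)` by at least a constant times `ε √N`. -/
lemma exists_large_increment (hH : ¬ FiniteDimensional ℂ H) {w : ℝ → ℝ}
    (hw : IsLittlewoodPaleyWindow w) :
    ∃ κ : ℝ, 0 < κ ∧ ∀ N : ℕ, 0 < N → ∀ ε : ℝ, 0 ≤ ε → ε ≤ 1 / 8 →
      ∃ (f : EuclideanSpace ℝ (Fin 2) → ℂ) (A₁ A₂ B : H →L[ℂ] H),
        MemBesov w f ∧ besovNorm w f = 1 ∧ IsFiniteRankSelfAdjoint A₁ ∧
        IsFiniteRankSelfAdjoint A₂ ∧ IsFiniteRankSelfAdjoint B ∧ ‖A₁ - A₂‖ ≤ ε ∧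
        LinearMap.rank ((A₁ - A₂ : H →L[ℂ] H) : H →ₗ[ℂ] H) ≤ N ∧
        κ * ε * √N ≤ ‖opFun f A₁ B - opFun f A₂ B‖ := by
  obtain ⟨κ, hκ, hlat⟩ := hw.exists_memBesov_lattice
  refine ⟨κ, hκ, fun N hN ε hε0 hε => ?_⟩
  obtain ⟨c, hc1, hc⟩ := exists_unimodular_orthogonal N
  obtain ⟨u, hu⟩ := exists_orthonormal_fin hH N
  obtain ⟨f, γ, hγ, hf, hf1, hfint, hf0, hfinc⟩ := hlat N hN c hc1
  have hv : Orthonormal ℂ (rotatedSystem c u) := orthonormal_rotatedSystem hN hu hc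
  have hf0' : ∀ y : ℝ, f !₂[0, y] = 0 := fun y => by simpa using hfint 0 y
  have hdiff : diagOp u (fun i => (i : ℝ) + 1 + ε) - diagOp u (fun i => (i : ℝ) + 1) =
      diagOp u fun _ => ε := by
    rw [diagOp_sub]
    congr 1
    ext i
    simp
  refine ⟨f, diagOp u fun i => (i : ℝ) + 1 + ε, diagOp u fun i => (i : ℝ) + 1,
    diagOp (rotatedSystem c u) fun j => (j : ℝ) + 1, hf, hf1, isFiniteRankSelfAdjoint_diagOp _ _,
    isFiniteRankSelfAdjoint_diagOp _ _, isFiniteRankSelfAdjoint_diagOp _ _, ?_, ?_, ?_⟩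
  · rw [hdiff]
    exact (norm_diagOp_const_le hu ε).trans (abs_of_nonneg hε0).le
  · rw [hdiff]
    exact rank_diagOp_le u _
  -- The eigenvalues of `A₂` are integers, so all terms of `f(A₂, B)` vanish.
  · have h1 : ∀ (i : Fin N) (y : ℝ), f !₂[(i : ℝ) + 1, y] = 0 := fun i y => by
      simpa using hfint (i + 1) y
    rw [opFun_diagOp hu hv _ _ hf0 hf0', opFun_diagOp hu hv _ _ hf0 hf0']
    simp only [h1, zero_smul, Finset.sum_const_zero, sub_zero,
      hfinc _ _ ε (by rwa [abs_of_nonneg hε0])]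
    refine le_trans ?_ (le_norm_sum_rankOne_comp_rankOne hN hu hc1 hc
      (mul_nonneg (hκ.le.trans hγ) hε0))
    gcongr

/-- Here `N = n + 1` and `ε = N^{-s} / 8`; the divisor 8 keeps the shift in the region where the
bump equals the coordinate. The exponent `s` is left free so that both norms can be treated. -/
lemma exists_sequences (hH : ¬ FiniteDimensional ℂ H) {w : ℝ → ℝ}
    (hw : IsLittlewoodPaleyWindow w) {s : ℝ} (hs : 0 ≤ s) :
    ∃ (κ : ℝ) (f : ℕ → EuclideanSpace ℝ (Fin 2) → ℂ) (A₁ A₂ B : ℕ → H →L[ℂ] H), 0 < κ ∧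
      (∀ n, MemBesov w (f n)) ∧
      (∀ n, besovNorm w (f n) = 1) ∧
      (∀ n, IsFiniteRankSelfAdjoint (A₁ n)) ∧
      (∀ n, IsFiniteRankSelfAdjoint (A₂ n)) ∧
      (∀ n, IsFiniteRankSelfAdjoint (B n)) ∧
      (∀ n, ‖A₁ n - A₂ n‖ ≤ ((n + 1 : ℕ) : ℝ) ^ (-s)) ∧
      (∀ n, LinearMap.rank ((A₁ n - A₂ n : H →L[ℂ] H) : H →ₗ[ℂ] H) ≤ (n + 1 : ℕ)) ∧
      ∀ n, κ * ((n + 1 : ℕ) : ℝ) ^ (1 / 2 - s) ≤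
        ‖opFun (f n) (A₁ n) (B n) - opFun (f n) (A₂ n) (B n)‖ := by
  obtain ⟨κ, hκ, h⟩ := exists_large_increment hH hw
  have hpow : ∀ n : ℕ, ((n + 1 : ℕ) : ℝ) ^ (-s) ≤ 1 := fun n =>
    Real.rpow_le_one_of_one_le_of_nonpos (by simp) (by linarith)
  have hpow0 : ∀ n : ℕ, 0 ≤ ((n + 1 : ℕ) : ℝ) ^ (-s) := fun n => by positivity
  choose f A₁ A₂ B hf hf1 hA₁ hA₂ hB hd hr hl using fun n : ℕ =>
    h (n + 1) n.succ_pos (((n + 1 : ℕ) : ℝ) ^ (-s) / 8) (by linarith [hpow0 n])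
      (by linarith [hpow n])
  refine ⟨κ / 8, f, A₁, A₂, B, by positivity, hf, hf1, hA₁, hA₂, hB,
    fun n => (hd n).trans (by linarith [hpow0 n]), hr, fun n => le_of_eq_of_le ?_ (hl n)⟩
  rw [Real.sqrt_eq_rpow, sub_eq_neg_add, Real.rpow_add (by positivity)]
  ring

lemma tendsto_natCast_succ_rpow_atTop {s : ℝ} (hs : 0 < s) :
    Tendsto (fun n : ℕ => ((n + 1 : ℕ) : ℝ) ^ s) atTop atTop :=
  (tendsto_rpow_atTop hs).comp
    (tendsto_natCast_atTop_atTop.comp (tendsto_add_atTop_nat 1))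

lemma tendsto_natCast_succ_rpow_neg {s : ℝ} (hs : 0 < s) :
    Tendsto (fun n : ℕ => ((n + 1 : ℕ) : ℝ) ^ (-s)) atTop (𝓝 0) :=
  (tendsto_rpow_neg_atTop hs).comp
    (tendsto_natCast_atTop_atTop.comp (tendsto_add_atTop_nat 1))

lemma exists_sequences_opNorm (hH : ¬ FiniteDimensional ℂ H) {w : ℝ → ℝ}
    (hw : IsLittlewoodPaleyWindow w) :
    ∃ (f : ℕ → EuclideanSpace ℝ (Fin 2) → ℂ) (A₁ A₂ B : ℕ → H →L[ℂ] H),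
      (∀ n, MemBesov w (f n)) ∧
      (∀ n, besovNorm w (f n) = 1) ∧
      (∀ n, IsFiniteRankSelfAdjoint (A₁ n)) ∧
      (∀ n, IsFiniteRankSelfAdjoint (A₂ n)) ∧
      (∀ n, IsFiniteRankSelfAdjoint (B n)) ∧
      Tendsto (fun n => ‖A₁ n - A₂ n‖) atTop (𝓝 0) ∧
      Tendsto (fun n => ‖opFun (f n) (A₁ n) (B n) - opFun (f n) (A₂ n) (B n)‖) atTop atTop := by
  obtain ⟨κ, f, A₁, A₂, B, hκ, hf, hf1, hA₁, hA₂, hB, hd, -, hl⟩ :=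
    -- Any exponent strictly between 0 and `1/2` would do.
    exists_sequences hH hw (s := 1 / 4) (by norm_num)
  refine ⟨f, A₁, A₂, B, hf, hf1, hA₁, hA₂, hB, ?_, ?_⟩
  · exact squeeze_zero (fun n => norm_nonneg _) hd (tendsto_natCast_succ_rpow_neg (by norm_num))
  · exact tendsto_atTop_mono hl
      ((tendsto_natCast_succ_rpow_atTop (by norm_num)).const_mul_atTop hκ)

lemma exists_sequences_schattenNorm (hH : ¬ FiniteDimensional ℂ H) {w : ℝ → ℝ}
    (hw : IsLittlewoodPaleyWindow w) {p : ℝ} (hp : 2 < p) :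
    ∃ (f : ℕ → EuclideanSpace ℝ (Fin 2) → ℂ) (A₁ A₂ B : ℕ → H →L[ℂ] H),
      (∀ n, MemBesov w (f n)) ∧
      (∀ n, besovNorm w (f n) = 1) ∧
      (∀ n, IsFiniteRankSelfAdjoint (A₁ n)) ∧
      (∀ n, IsFiniteRankSelfAdjoint (A₂ n)) ∧
      (∀ n, IsFiniteRankSelfAdjoint (B n)) ∧
      Tendsto (fun n => schattenNorm p (A₁ n - A₂ n)) atTop (𝓝 0) ∧
      Tendsto (fun n => schattenNorm p
        (opFun (f n) (A₁ n) (B n) - opFun (f n) (A₂ n) (B n))) atTop (𝓝 ∞) := by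
  have hp0 : 0 < p := by linarith
  have hp1 : 0 < 1 / p := by positivity
  have hp2 : 1 / p < 1 / 2 := one_div_lt_one_div_of_lt two_pos hp
  obtain ⟨κ, f, A₁, A₂, B, hκ, hf, hf1, hA₁, hA₂, hB, hd, hr, hl⟩ :=
    -- The midpoint of `1/p` and `1/2`: the perturbation is at most `N^{1/p - s}` and the increment
    -- at least `κ N^{1/2 - s}`.
    exists_sequences hH hw (s := 1 / 4 + 1 / p / 2) (by linarith)
  refine ⟨f, A₁, A₂, B, hf, hf1, hA₁, hA₂, hB, ?_, ?_⟩
  · have h0 := (ENNReal.continuous_ofReal.tendsto 0).comp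
      (tendsto_natCast_succ_rpow_neg (s := 1 / 4 - 1 / p / 2) (by linarith))
    rw [ENNReal.ofReal_zero] at h0
    refine tendsto_of_tendsto_of_tendsto_of_le_of_le tendsto_const_nhds h0 (fun n => bot_le)
      fun n => ?_
    have hn : (0 : ℝ) < ((n + 1 : ℕ) : ℝ) := by positivity
    calc schattenNorm p (A₁ n - A₂ n)
        ≤ ((n + 1 : ℕ) : ℝ≥0∞) ^ (1 / p) * ‖A₁ n - A₂ n‖ₑ := schattenNorm_le_of_rank_le hp0 (hr n)
      _ ≤ ENNReal.ofReal (((n + 1 : ℕ) : ℝ) ^ (1 / p)) *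
          ENNReal.ofReal (((n + 1 : ℕ) : ℝ) ^ (-(1 / 4 + 1 / p / 2))) := by
        rw [← ofReal_norm, ← ENNReal.ofReal_rpow_of_pos hn, ENNReal.ofReal_natCast]
        gcongr
        exact hd n
      _ = ENNReal.ofReal (((n + 1 : ℕ) : ℝ) ^ (-(1 / 4 - 1 / p / 2))) := by
        rw [← ENNReal.ofReal_mul (by positivity), ← Real.rpow_add hn]
        congr 2
        ring
  · have h1 : Tendsto (fun n : ℕ => ENNReal.ofReal
        (κ * ((n + 1 : ℕ) : ℝ) ^ (1 / 2 - (1 / 4 + 1 / p / 2)))) atTop (𝓝 ∞) :=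
      ENNReal.tendsto_ofReal_nhds_top.mpr
        ((tendsto_natCast_succ_rpow_atTop (by linarith)).const_mul_atTop hκ)
    refine tendsto_of_tendsto_of_tendsto_of_le_of_le h1 tendsto_const_nhds (fun n => ?_)
      fun n => le_top
    refine le_trans ?_ (enorm_le_schattenNorm hp0 _)
    rw [← ofReal_norm]
    exact ENNReal.ofReal_le_ofReal (hl n)

end Counterexample

end

theorem theorem8p2 {H : Type*} [NormedAddCommGroup H] [InnerProductSpace ℂ H] [CompleteSpace H]
    (hH : ¬ FiniteDimensional ℂ H) (w : ℝ → ℝ) (hw : IsLittlewoodPaleyWindow w) :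
    -- the operator norm
    (∃ (f : ℕ → EuclideanSpace ℝ (Fin 2) → ℂ) (A₁ A₂ B : ℕ → H →L[ℂ] H),
      (∀ n, MemBesov w (f n)) ∧
      (∀ m n, besovNorm w (f m) = besovNorm w (f n)) ∧
      (∀ n, IsFiniteRankSelfAdjoint (A₁ n)) ∧
      (∀ n, IsFiniteRankSelfAdjoint (A₂ n)) ∧
      (∀ n, IsFiniteRankSelfAdjoint (B n)) ∧
      Tendsto (fun n => ‖A₁ n - A₂ n‖) atTop (𝓝 0) ∧
      Tendsto (fun n => ‖opFun (f n) (A₁ n) (B n) - opFun (f n) (A₂ n) (B n)‖) atTop atTop) ∧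
    -- the norm of `S_p`, `p > 2`
    (∀ p : ℝ, 2 < p →
      ∃ (f : ℕ → EuclideanSpace ℝ (Fin 2) → ℂ) (A₁ A₂ B : ℕ → H →L[ℂ] H),
        (∀ n, MemBesov w (f n)) ∧
        (∀ m n, besovNorm w (f m) = besovNorm w (f n)) ∧
        (∀ n, IsFiniteRankSelfAdjoint (A₁ n)) ∧
        (∀ n, IsFiniteRankSelfAdjoint (A₂ n)) ∧
        (∀ n, IsFiniteRankSelfAdjoint (B n)) ∧
        Tendsto (fun n => schattenNorm p (A₁ n - A₂ n)) atTop (𝓝 0) ∧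
        Tendsto (fun n => schattenNorm p
          (opFun (f n) (A₁ n) (B n) - opFun (f n) (A₂ n) (B n))) atTop (𝓝 ∞)) ∧
    -- no Lipschitz type estimate in the operator norm, even for small perturbations
    (∀ M δ : ℝ, 0 < δ →
      ∃ (f : EuclideanSpace ℝ (Fin 2) → ℂ) (A₁ A₂ B : H →L[ℂ] H),
        MemBesov w f ∧ IsFiniteRankSelfAdjoint A₁ ∧ IsFiniteRankSelfAdjoint A₂ ∧
        IsFiniteRankSelfAdjoint B ∧ ‖A₁ - A₂‖ < δ ∧
        M * (besovNorm w f).toReal * ‖A₁ - A₂‖ < ‖opFun f A₁ B - opFun f A₂ B‖) ∧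
    -- no Lipschitz type estimate in the norm of `S_p`, `p > 2`, even for small perturbations
    (∀ p : ℝ, 2 < p → ∀ (M : ℝ≥0) (δ : ℝ≥0∞), 0 < δ →
      ∃ (f : EuclideanSpace ℝ (Fin 2) → ℂ) (A₁ A₂ B : H →L[ℂ] H),
        MemBesov w f ∧ IsFiniteRankSelfAdjoint A₁ ∧ IsFiniteRankSelfAdjoint A₂ ∧
        IsFiniteRankSelfAdjoint B ∧ schattenNorm p (A₁ - A₂) < δ ∧
        M * besovNorm w f * schattenNorm p (A₁ - A₂) <
          schattenNorm p (opFun f A₁ B - opFun f A₂ B)) := by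
  obtain ⟨f, A₁, A₂, B, hf, hf1, hA₁, hA₂, hB, hd, hl⟩ := exists_sequences_opNorm hH hw
  refine ⟨⟨f, A₁, A₂, B, hf, fun m n => by rw [hf1, hf1], hA₁, hA₂, hB, hd, hl⟩, fun p hp => ?_,
    fun M δ hδ => ?_, fun p hp M δ hδ => ?_⟩
  · obtain ⟨f, A₁, A₂, B, hf, hf1, hA₁, hA₂, hB, hd, hl⟩ := exists_sequences_schattenNorm hH hw hp
    exact ⟨f, A₁, A₂, B, hf, fun m n => by rw [hf1, hf1], hA₁, hA₂, hB, hd, hl⟩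
  -- As the Besov norm is 1, a perturbation smaller than 1 with an increment above `|M|` suffices.
  · obtain ⟨n, h1, h2, h3⟩ := ((hd.eventually (gt_mem_nhds hδ)).and
      ((hd.eventually (gt_mem_nhds one_pos)).and (hl.eventually_gt_atTop |M|))).exists
    refine ⟨f n, A₁ n, A₂ n, B n, hf n, hA₁ n, hA₂ n, hB n, h1, ?_⟩
    rw [hf1, ENNReal.toReal_one, mul_one]
    calc M * ‖A₁ n - A₂ n‖ ≤ |M| * 1 :=
          mul_le_mul (le_abs_self M) h2.le (norm_nonneg _) (abs_nonneg M)
      _ < _ := by rwa [mul_one]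
  · obtain ⟨f, A₁, A₂, B, hf, hf1, hA₁, hA₂, hB, hd, hl⟩ := exists_sequences_schattenNorm hH hw hp
    obtain ⟨n, h1, h2, h3⟩ := ((hd.eventually (gt_mem_nhds hδ)).and
      ((hd.eventually (gt_mem_nhds one_pos)).and
        (hl.eventually (lt_mem_nhds (ENNReal.coe_lt_top (r := M)))))).exists
    refine ⟨f n, A₁ n, A₂ n, B n, hf n, hA₁ n, hA₂ n, hB n, h1, ?_⟩
    rw [hf1, mul_one]
    exact (mul_le_of_le_one_right' h2.le).trans_lt h3
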